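/- Let $n\ge k\ge 2$ be integers. An $(n,k)$-Sperner partition system is a set of partitions of some $n$-element set such that each partition has exactly $k$ nonempty parts and no part in any partition is a subset of a part in a different partition. Let $\mathrm{SP}(n,k)$ denote the maximum number of partitions in an $(n,k)$-Sperner partition system. Write $n=ck+r$ with integers $c,r$ and $r\in\{0,\ldots,k-1\}$, and let $$\mathrm{MMS}(n,k)=\frac{\binom{n}{c}}{k-r+\frac{r(c+1)}{n-c}}.$$ (a) Let $n$ and $k$ be integers (with $k$ allowed to vary with $n$) such that $n\to\infty$ with $n\equiv k+1 \pmod{2k}$, $k=o(n)$, and $k\ge 3$ is odd. Then $\mathrm{SP}(n,k)\sim\mathrm{MMS}(n,k)$. (b) Let $n$ and $k$ be integers (with $k$ allowed to vary with $n$) such that $n\to\infty$ with $n\equiv k-1 \pmod{2k}$, $k=o(n)$, and $k\ge 5$ is odd. Then $\mathrm{SP}(n,k)\sim\mathrm{MMS}(n,k)$. Here the limits are taken along any sequence of pairs $(n,k)$ satisfying the stated conditions, and $f\sim g$ means $f/g\to 1$ along that sequence. -/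

import Mathlib

open Filter Asymptotics

/-- A set `S` of partitions of the `n`-set `Fin n` is an `(n, k)`-Sperner partition system if each
partition in `S` has exactly `k` parts (parts of a `Finpartition` are nonempty) and no part of a
partition in `S` is a subset of a part of a different partition in `S`. -/
def IsSpernerPartitionSystem (n k : ℕ) (S : Finset (Finpartition (Finset.univ : Finset (Fin n)))) :
    Prop :=
  (∀ P ∈ S, P.parts.card = k) ∧
    ∀ P ∈ S, ∀ Q ∈ S, P ≠ Q → ∀ A ∈ P.parts, ∀ B ∈ Q.parts, ¬ A ⊆ B

/-- `SP n k` is the maximum number of partitions in an `(n, k)`-Sperner partition system. -/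
noncomputable def SP (n k : ℕ) : ℕ :=
  sSup {m : ℕ | ∃ S, IsSpernerPartitionSystem n k S ∧ S.card = m}

/-- The maximum defining `SP n k` is attained. -/
theorem SP_isGreatest (n k : ℕ) :
    IsGreatest {m : ℕ | ∃ S, IsSpernerPartitionSystem n k S ∧ S.card = m} (SP n k) := by
  have hne : {m : ℕ | ∃ S, IsSpernerPartitionSystem n k S ∧ S.card = m}.Nonempty :=
    ⟨0, ∅, by simp [IsSpernerPartitionSystem], rfl⟩
  have hbd : BddAbove {m : ℕ | ∃ S, IsSpernerPartitionSystem n k S ∧ S.card = m} := by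
    refine ⟨Fintype.card (Finpartition (Finset.univ : Finset (Fin n))), ?_⟩
    rintro m ⟨S, -, rfl⟩
    exact S.card_le_univ
  exact ⟨Nat.sSup_mem hne hbd, fun m hm => le_csSup hbd hm⟩

/-- The quantity `MMS(n, k) = binom(n, c) / (k - r + r (c + 1) / (n - c))`, where `n = c k + r` with
`0 ≤ r < k`; here `c = n / k` and `r = n % k` are the quotient and the remainder of `n` by `k`. -/
noncomputable def MMS (n k : ℕ) : ℝ :=
  (n.choose (n / k) : ℝ) /
    ((k : ℝ) - ((n % k : ℕ) : ℝ) +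
      ((n % k : ℕ) : ℝ) * (((n / k : ℕ) : ℝ) + 1) / ((n : ℝ) - ((n / k : ℕ) : ℝ)))

/-! Upper bound (`SP_le_MMS`). All parts of a Sperner partition system form an antichain, so the LYM
inequality bounds the sum of `1 / binom(n, |A|)` over all parts `A` by one. Since `x ↦ 1 / binom(n,
x)` is convex on integers, it lies above its chord through `c` and `c + 1`; as `k` parts have total
size `n`, every partition contributes at least `1 / MMS`.

Lower bound. In both cases `n = 2 h`, `k = 2 t + 1`, and each partition gets one part of size `2 m'`
and `2 t` parts of size `2 m + 1`, with `m' = m + 1` in (a) and `m' = m` in (b). The ground set is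
cut into two halves, and the type of a set is the pair of its intersection sizes. A Baranyai-type
theorem (`exists_partitions_of_types`) realises every family of type lists with the right sums that
uses no type more often than there are sets of it. It remains to design types, any two equal or
incomparable.

The types `(m' + u, m' - u)` and `(m + 1 + v, m - v)` are comparable only if `v ≤ u ≤ v + 1`. Hence
`u` is confined to short intervals around the multiples of `Q` and `v` to the complementary
intervals, `L` times as long: the two layers are used in proportions close to `1 / (L + 1)` and `L /
(L + 1)`. The sums come out right if `u + v₁ + v₂ + 1 = 0`, the remaining odd parts being paired as
`v₁`, `-1 - v₁`. Zero-sum triples with a given unimodal marginal exist because such a weight is a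
sum of uniform weights on `{-R, …, R}`, each of which has an explicit coupling
(`exists_triples_sum_zero`, `exists_separated_triples`). The ideal `L` is `1` in (b) and `4 t²`,
capped at a constant, in (a). The losses vanish as `n / k → ∞`, because a single type is then a
negligible share of its layer (`layerCount_zero_le`). -/

/-! ### Integral rounding of nonnegative matrices -/

/-- A nonnegative matrix with unit row sums and column sums at most one has a transversal. -/
theorem exists_injective_of_row_sum_eq_one {ι κ : Type*} [Fintype ι] [Fintype κ]
    [DecidableEq κ] (f : ι → κ → ℚ) (hf : ∀ i j, 0 ≤ f i j) (hrow : ∀ i, ∑ j, f i j = 1)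
    (hcol : ∀ j, ∑ i, f i j ≤ 1) : ∃ g : ι → κ, Function.Injective g ∧ ∀ i, 0 < f i (g i) := by
  classical
  have key := (Finset.all_card_le_biUnion_card_iff_exists_injective
    (fun i => Finset.univ.filter (fun j => 0 < f i j))).1 (by
      intro s
      have h1 : (s.card : ℚ) = ∑ i ∈ s, ∑ j ∈ s.biUnion
          (fun i => Finset.univ.filter (fun j => 0 < f i j)), f i j := by
        rw [Finset.card_eq_sum_ones, Nat.cast_sum]
        refine Finset.sum_congr rfl fun i hi => ?_
        rw [Nat.cast_one, ← hrow i]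
        symm
        refine Finset.sum_subset (Finset.subset_univ _) fun j _ hj => ?_
        by_contra hne
        exact hj (Finset.mem_biUnion.2 ⟨i, hi, by
          simpa using lt_of_le_of_ne (hf i j) (Ne.symm hne)⟩)
      rw [Finset.sum_comm] at h1
      have h2 : (s.card : ℚ) ≤ ((s.biUnion
          (fun i => Finset.univ.filter (fun j => 0 < f i j))).card : ℚ) := by
        rw [h1, Finset.card_eq_sum_ones, Nat.cast_sum]
        refine Finset.sum_le_sum fun j _ => ?_
        rw [Nat.cast_one]
        exact (Finset.sum_le_sum_of_subset_of_nonneg (Finset.subset_univ s)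
          fun i _ _ => hf i j).trans (hcol j)
      exact_mod_cast h2)
  obtain ⟨g, hg, hg'⟩ := key
  exact ⟨g, hg, fun i => by simpa using hg' i⟩

/-- A nonnegative matrix with unit row sums can be rounded to a choice function all of whose fibres
have the floor or the ceiling of the column sum as cardinality. -/
theorem exists_rounding {ι κ : Type*} [Fintype ι] [Fintype κ] [DecidableEq κ]
    (f : ι → κ → ℚ) (hf : ∀ i j, 0 ≤ f i j) (hrow : ∀ i, ∑ j, f i j = 1) :
    ∃ g : ι → κ, (∀ i, 0 < f i (g i)) ∧ ∀ j,
      ⌊∑ i, f i j⌋₊ ≤ (Finset.univ.filter (fun i => g i = j)).card ∧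
      (Finset.univ.filter (fun i => g i = j)).card ≤ ⌈∑ i, f i j⌉₊ := by
  classical
  set F : κ → ℚ := fun j => ∑ i, f i j with hF
  have hF0 : ∀ j, 0 ≤ F j := fun j => Finset.sum_nonneg fun i _ => hf i j
  have hcard : (Fintype.card ι : ℚ) = ∑ j, F j := by
    simp only [hF]
    rw [Finset.sum_comm]
    simp [hrow]
  set m : ℕ := ∑ j, ⌈F j⌉₊ with hm
  have hmF : (m : ℚ) = ∑ j, (⌈F j⌉₊ : ℚ) := by simp [hm]
  have hpm : Fintype.card ι ≤ m := by
    have : (Fintype.card ι : ℚ) ≤ m := by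
      rw [hcard, hmF]
      exact Finset.sum_le_sum fun j _ => Nat.le_ceil _
    exact_mod_cast this
  -- `δ` dummy rows make the enlarged matrix square; together they carry the total excess of the
  -- ceilings over the column sums.
  set δ : ℕ := m - Fintype.card ι with hδ
  have hδ' : (δ : ℚ) = ∑ j, ((⌈F j⌉₊ : ℚ) - F j) := by
    rw [hδ, Nat.cast_sub hpm, hcard, hmF, Finset.sum_sub_distrib]
  -- Column `j` is split into `⌊F j⌋₊` columns filled entirely by genuine rows and, if `F j` is not
  -- an integer, one more holding the fractional part, topped up by dummy rows.
  let M : ι ⊕ Fin δ → (Σ j : κ, Fin ⌈F j⌉₊) → ℚ := fun r x =>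
    match r with
    | Sum.inl i => if (x.2 : ℕ) < ⌊F x.1⌋₊ then f i x.1 / F x.1
        else f i x.1 * (1 - ⌊F x.1⌋₊ / F x.1)
    | Sum.inr _ => if (x.2 : ℕ) < ⌊F x.1⌋₊ then 0 else (⌈F x.1⌉₊ - F x.1) / δ
  have hfl : ∀ j, (⌊F j⌋₊ : ℚ) ≤ F j := fun j => Nat.floor_le (hF0 j)
  have hcl : ∀ j, F j ≤ (⌈F j⌉₊ : ℚ) := fun j => Nat.le_ceil _
  have hceil : ∀ j, ⌈F j⌉₊ = ⌊F j⌋₊ ∧ F j = ⌊F j⌋₊ ∨ ⌈F j⌉₊ = ⌊F j⌋₊ + 1 := by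
    intro j
    rcases (hfl j).eq_or_lt with h | h
    · left
      refine ⟨?_, h.symm⟩
      rw [← h]; simp
    · right
      refine le_antisymm (Nat.ceil_le_floor_add_one _) ?_
      exact_mod_cast lt_of_lt_of_le h (hcl j)
  have hsplit : ∀ (j : κ) (A C : ℚ),
      ∑ t : Fin ⌈F j⌉₊, (if (t : ℕ) < ⌊F j⌋₊ then A else C) =
        ⌊F j⌋₊ * A + ((⌈F j⌉₊ : ℚ) - ⌊F j⌋₊) * C := by
    intro j A C
    rw [Fin.sum_univ_eq_sum_range (fun t => if t < ⌊F j⌋₊ then A else C)]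
    rcases hceil j with ⟨h, -⟩ | h
    · rw [h, Finset.sum_congr rfl (g := fun _ => A)
        (fun t ht => if_pos (Finset.mem_range.1 ht))]
      simp
    · rw [h, Finset.sum_range_succ, Finset.sum_congr rfl (g := fun _ => A)
        (fun t ht => if_pos (Finset.mem_range.1 ht))]
      simp
  obtain ⟨g, hginj, hg⟩ := exists_injective_of_row_sum_eq_one M
    (by
      rintro (i | d) ⟨j, t⟩
      · simp only [M]
        split_ifs
        · exact div_nonneg (hf _ _) (hF0 _)
        · exact mul_nonneg (hf _ _) (sub_nonneg.2 (div_le_one_of_le₀ (hfl j) (hF0 j)))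
      · simp only [M]
        split_ifs
        · exact le_rfl
        · exact div_nonneg (sub_nonneg.2 (hcl j)) (Nat.cast_nonneg _))
    (by
      rintro (i | d)
      · rw [Fintype.sum_sigma, ← hrow i]
        refine Finset.sum_congr rfl fun j _ => ?_
        simp only [M]
        rw [hsplit]
        rcases (hF0 j).eq_or_lt with h0 | h0
        · have : f i j = 0 := by
            have := (Finset.sum_eq_zero_iff_of_nonneg (fun i _ => hf i j)).1 h0.symm i
              (Finset.mem_univ _)
            exact this
          simp [this]
        · rcases hceil j with ⟨h, h'⟩ | h
          · rw [h, ← h']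
            field_simp
            ring
          · rw [h]
            push_cast
            field_simp
            ring
      · have hδ0 : (δ : ℚ) ≠ 0 := by
          have := d.pos
          positivity
        rw [Fintype.sum_sigma]
        have : ∀ j, ∑ t : Fin ⌈F j⌉₊, M (Sum.inr d) ⟨j, t⟩ = ((⌈F j⌉₊ : ℚ) - F j) / δ := by
          intro j
          simp only [M]
          rw [hsplit]
          rcases hceil j with ⟨h, h'⟩ | h
          · rw [h, ← h']; simp
          · rw [h]; push_cast; ring
        rw [Finset.sum_congr rfl fun j _ => this j, ← Finset.sum_div, ← hδ', div_self hδ0])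
    (by
      rintro ⟨j, t⟩
      have hc0 : 0 < ⌈F j⌉₊ := t.pos
      have hFpos : 0 < F j := Nat.ceil_pos.1 hc0
      rw [Fintype.sum_sum_type]
      simp only [M]
      split_ifs with h
      · rw [← Finset.sum_div]
        simp only [Finset.sum_const_zero, add_zero]
        exact (div_self hFpos.ne').le
      · rw [← Finset.sum_mul, Finset.sum_const, Finset.card_univ, Fintype.card_fin, nsmul_eq_mul]
        have h1 : (∑ i, f i j) * (1 - (⌊F j⌋₊ : ℚ) / F j) = F j - ⌊F j⌋₊ := by
          change F j * _ = _
          field_simp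
        rw [h1]
        have h2 : (δ : ℚ) * (((⌈F j⌉₊ : ℚ) - F j) / δ) ≤ (⌈F j⌉₊ : ℚ) - F j := by
          rcases eq_or_ne (δ : ℚ) 0 with h0 | h0
          · rw [h0, zero_mul]; exact sub_nonneg.2 (hcl j)
          · rw [mul_div_cancel₀ _ h0]
        have h3 : (⌈F j⌉₊ : ℚ) ≤ ⌊F j⌋₊ + 1 := by exact_mod_cast Nat.ceil_le_floor_add_one (F j)
        linarith)
  have hbij : Function.Bijective g := by
    rw [Fintype.bijective_iff_injective_and_card]
    refine ⟨hginj, ?_⟩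
    simp only [Fintype.card_sum, Fintype.card_fin, Fintype.card_sigma]
    omega
  refine ⟨fun i => (g (Sum.inl i)).1, fun i => ?_, fun j => ⟨?_, ?_⟩⟩
  · have := hg (Sum.inl i)
    by_contra h0
    have h0 : f i (g (Sum.inl i)).1 = 0 := le_antisymm (not_lt.1 h0) (hf _ _)
    simp [M, h0] at this
  · have hlt : ⌊F j⌋₊ ≤ ⌈F j⌉₊ := Nat.floor_le_ceil _
    -- Dummy rows have weight zero in the first `⌊F j⌋₊` copies of `j`, so genuine rows must occupy
    -- them.
    have hex : ∀ t : Fin ⌊F j⌋₊, ∃ i, g (Sum.inl i) = ⟨j, Fin.castLE hlt t⟩ := by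
      intro t
      obtain ⟨r, hr⟩ := hbij.2 ⟨j, Fin.castLE hlt t⟩
      rcases r with i | d
      · exact ⟨i, hr⟩
      · have := hg (Sum.inr d)
        rw [hr] at this
        simp [M] at this
    choose φ hφ using hex
    have hφinj : Function.Injective φ := by
      intro s t hst
      have := (hφ s).symm.trans (hst ▸ hφ t)
      simpa using this
    calc ⌊F j⌋₊ = (Finset.univ.image φ).card := by
          rw [Finset.card_image_of_injective _ hφinj]; simp
      _ ≤ _ := Finset.card_le_card fun i hi => by
          obtain ⟨t, -, rfl⟩ := Finset.mem_image.1 hi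
          simp [hφ t]
  · have hsub : (Finset.univ.filter (fun i => (g (Sum.inl i)).1 = j)).image
        (fun i => g (Sum.inl i)) ⊆
        Finset.univ.image (fun t : Fin ⌈F j⌉₊ => (⟨j, t⟩ : Σ j : κ, Fin ⌈F j⌉₊)) := by
      intro x hx
      obtain ⟨i, hi, rfl⟩ := Finset.mem_image.1 hx
      obtain rfl := (Finset.mem_filter.1 hi).2
      exact Finset.mem_image.2 ⟨_, Finset.mem_univ _, rfl⟩
    have h := (Finset.card_le_card hsub).trans Finset.card_image_le
    rwa [Finset.card_image_of_injective _ (fun a b hab => by simpa using hginj hab),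
      Finset.card_univ, Fintype.card_fin] at h

/-- A weighting of the cells of a family, with total weight one in each row, can be rounded to a
choice of one cell from each row, preserving the total weight of each class up to rounding. -/
theorem exists_cell_rounding {ι A κ : Type*} [Fintype ι] [Fintype A] [DecidableEq κ]
    (cls : ι → A → κ) (y : ι → A → ℚ) (hy : ∀ i a, 0 ≤ y i a) (hrow : ∀ i, ∑ a, y i a = 1) :
    ∃ g : ι → A, (∀ i, 0 < y i (g i)) ∧ ∀ z,
      ⌊∑ i, ∑ a, if cls i a = z then y i a else 0⌋₊ ≤
        (Finset.univ.filter (fun i => cls i (g i) = z)).card ∧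
      (Finset.univ.filter (fun i => cls i (g i) = z)).card ≤
        ⌈∑ i, ∑ a, if cls i a = z then y i a else 0⌉₊ := by
  classical
  -- `κ` may be infinite, so only the classes that occur serve as columns.
  let I : Finset κ := Finset.univ.image (fun p : ι × A => cls p.1 p.2)
  have hI : ∀ i a, cls i a ∈ I := fun i a => Finset.mem_image.2 ⟨(i, a), Finset.mem_univ _, rfl⟩
  obtain ⟨g, hg, hg'⟩ := exists_rounding (κ := I)
    (fun i z => ∑ a, if cls i a = z.1 then y i a else 0)
    (fun i z => Finset.sum_nonneg fun a _ => by split_ifs <;> simp [hy])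
    (fun i => by
      rw [Finset.sum_comm, ← hrow i]
      refine Finset.sum_congr rfl fun a _ => ?_
      rw [Finset.sum_eq_single (⟨cls i a, hI i a⟩ : I)]
      · simp
      · rintro b - hb
        rw [if_neg]
        intro h
        exact hb (Subtype.ext h.symm)
      · simp)
  have hex : ∀ i, ∃ a, cls i a = (g i).1 ∧ 0 < y i a := by
    intro i
    obtain ⟨a, -, ha⟩ := Finset.exists_ne_zero_of_sum_ne_zero (hg i).ne'
    by_cases h : cls i a = (g i).1
    · rw [if_pos h] at ha
      exact ⟨a, h, lt_of_le_of_ne (hy i a) (Ne.symm ha)⟩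
    · rw [if_neg h] at ha
      exact absurd rfl ha
  choose φ hφ hφ' using hex
  refine ⟨φ, hφ', fun z => ?_⟩
  by_cases hz : z ∈ I
  · have := hg' ⟨z, hz⟩
    have he : (Finset.univ.filter (fun i => cls i (φ i) = z)) =
        Finset.univ.filter (fun i => g i = ⟨z, hz⟩) := by
      ext i
      simp only [Finset.mem_filter, Finset.mem_univ, true_and, hφ, Subtype.ext_iff]
    rw [he]
    exact this
  · have h1 : ∀ i a, cls i a ≠ z := fun i a h => hz (h ▸ hI i a)
    simp [h1]

/-! ### A Baranyai-type theorem for types -/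

theorem Nat.cast_choose_mul_sub (R s : ℕ) (h : s ≤ R) (hR : 0 < R) :
    ((R.choose s : ℕ) : ℚ) * (R - s) = R * ((R - 1).choose s : ℕ) := by
  obtain ⟨r, rfl⟩ : ∃ r, R = r + 1 := ⟨R - 1, by omega⟩
  have := Nat.choose_mul_succ_eq r s
  have h2 : ((r.choose s : ℕ) : ℚ) * ((r : ℚ) + 1) = ((r + 1).choose s : ℕ) * ((r + 1 : ℕ) - s) := by
    rw [← Nat.cast_sub h]
    exact_mod_cast this
  simp only [Nat.add_sub_cancel]
  push_cast at h2 ⊢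
  linarith

theorem Nat.cast_choose_mul (R s : ℕ) (hs : 0 < s) (hR : 0 < R) :
    ((R.choose s : ℕ) : ℚ) * s = R * ((R - 1).choose (s - 1) : ℕ) := by
  obtain ⟨r, rfl⟩ : ∃ r, R = r + 1 := ⟨R - 1, by omega⟩
  obtain ⟨u, rfl⟩ : ∃ u, s = u + 1 := ⟨s - 1, by omega⟩
  have := Nat.add_one_mul_choose_eq r u
  simp only [Nat.add_sub_cancel]
  exact_mod_cast this.symm

/-- The state of the Baranyai construction after the elements of `U` have been distributed. -/
structure PartialPartitions {V G Γ A : Type*} [Fintype V] [DecidableEq V] [Fintype G]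
    [DecidableEq G] [Fintype Γ] [Fintype A] [DecidableEq Γ] [DecidableEq A]
    (π : V → G) (τ : Γ → A → G → ℕ) (U : Finset V) (S : Γ → A → Finset V) : Prop where
  subset : ∀ γ a, S γ a ⊆ U
  disjoint : ∀ γ a a', a ≠ a' → Disjoint (S γ a) (S γ a')
  cover : ∀ γ, ∀ v ∈ U, ∃ a, v ∈ S γ a
  card_le : ∀ γ a b, ((S γ a).filter (fun v => π v = b)).card ≤ τ γ a b
  capacity : ∀ (t : G → ℕ) (Z : Finset V),
    (Finset.univ.filter (fun p : Γ × A => τ p.1 p.2 = t ∧ S p.1 p.2 = Z)).card ≤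
      ∏ b, (Uᶜ.filter (fun v => π v = b)).card.choose
        (t b - (Z.filter (fun v => π v = b)).card)

section

variable {V G Γ A : Type*} [Fintype V] [DecidableEq V] [Fintype G]
    [DecidableEq G] [Fintype Γ] [Fintype A] [DecidableEq Γ] [DecidableEq A]
    {π : V → G} {τ : Γ → A → G → ℕ}

theorem PartialPartitions.sum_card {U : Finset V} {S : Γ → A → Finset V}
    (h : PartialPartitions π τ U S) (γ : Γ) (b : G) :
    ∑ a, ((S γ a).filter (fun v => π v = b)).card = (U.filter (fun v => π v = b)).card := by
  rw [← Finset.card_biUnion]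
  · congr 1
    ext v
    simp only [Finset.mem_biUnion, Finset.mem_univ, true_and, Finset.mem_filter]
    constructor
    · rintro ⟨a, ha, hb⟩
      exact ⟨h.subset γ a ha, hb⟩
    · rintro ⟨hU, hb⟩
      obtain ⟨a, ha⟩ := h.cover γ v hU
      exact ⟨a, ha, hb⟩
  · intro a _ a' _ hne
    exact (h.disjoint γ a a' hne).mono (Finset.filter_subset _ _) (Finset.filter_subset _ _)

/-- The capacity invariant says that a partial set `Z` of type `t` occurs at most as often as it has
completions. The new element goes to a cell with weight (elements its group still lacks there) /
(undistributed elements of the group). A class lacking `s` of `R` elements then receives the share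
`s / R`, and `binom(R, s)` splits into `binom(R - 1, s - 1)` and `binom(R - 1, s)` in just this
ratio. -/
theorem PartialPartitions.step (hsum : ∀ γ b, ∑ a, τ γ a b =
      (Finset.univ.filter (fun v => π v = b)).card) {U : Finset V} {S : Γ → A → Finset V}
    (h : PartialPartitions π τ U S) (v : V) (hv : v ∉ U) :
    ∃ S', PartialPartitions π τ (insert v U) S' := by
  classical
  set b := π v with hb
  set R := (Uᶜ.filter (fun w => π w = b)).card with hR
  have hRpos : 0 < R := Finset.card_pos.2 ⟨v, by simp [hv, hb]⟩
  have hRq : (0 : ℚ) < R := by exact_mod_cast hRpos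
  have hcompl : (insert v U)ᶜ = Uᶜ.erase v := by
    ext w; simp
  have hrem : ∀ b', ((insert v U)ᶜ.filter (fun w => π w = b')).card =
      if b' = b then R - 1 else (Uᶜ.filter (fun w => π w = b')).card := by
    intro b'
    rw [hcompl, Finset.filter_erase]
    split_ifs with h1
    · rw [h1, Finset.card_erase_of_mem (by simp [hv, hb])]
    · rw [Finset.erase_eq_of_notMem]
      simp only [Finset.mem_filter, not_and]
      exact fun _ h2 => h1 h2.symm
  set used : Finset V → ℕ := fun Z => (Z.filter (fun w => π w = b)).card with hused
  have hle : ∀ γ a, used (S γ a) ≤ τ γ a b := fun γ a => h.card_le γ a b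
  obtain ⟨g, hg, hround⟩ := exists_cell_rounding
    (fun γ a => (τ γ a, S γ a)) (fun γ a => ((τ γ a b : ℚ) - used (S γ a)) / R)
    (fun γ a => div_nonneg (sub_nonneg.2 (by exact_mod_cast hle γ a)) hRq.le)
    (fun γ => by
      rw [← Finset.sum_div, Finset.sum_sub_distrib, ← Nat.cast_sum, ← Nat.cast_sum, hsum,
        h.sum_card γ b, div_eq_one_iff_eq hRq.ne', sub_eq_iff_eq_add]
      have : (Finset.univ.filter (fun v => π v = b)).card =
          R + (U.filter (fun w => π w = b)).card := by
        rw [hR, add_comm, ← Finset.card_union_of_disjoint, ← Finset.filter_union,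
          Finset.union_compl]
        exact Finset.disjoint_filter_filter disjoint_compl_right
      exact_mod_cast this)
  have hglt : ∀ γ, used (S γ (g γ)) < τ γ (g γ) b := by
    intro γ
    have h1 := hg γ
    rw [div_pos_iff_of_pos_right hRq, sub_pos] at h1
    exact_mod_cast h1
  have hvS : ∀ γ a, v ∉ S γ a := fun γ a hm => hv (h.subset γ a hm)
  -- The two bounds concern the cells of a class that receive `v` and those that do not. The new
  -- capacities are integers, so rounding does not break them.
  have hcount : ∀ (t : G → ℕ) (Z : Finset V),
      (Finset.univ.filter (fun γ => ((τ γ (g γ), S γ (g γ)) : _ × _) = (t, Z))).card ≤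
        (if used Z < t b then (R - 1).choose (t b - used Z - 1) else 0) *
          ∏ b' ∈ Finset.univ.erase b, (Uᶜ.filter (fun w => π w = b')).card.choose
            (t b' - (Z.filter (fun w => π w = b')).card) ∧
      (Finset.univ.filter (fun p : Γ × A => τ p.1 p.2 = t ∧ S p.1 p.2 = Z)).card -
        (Finset.univ.filter (fun γ => ((τ γ (g γ), S γ (g γ)) : _ × _) = (t, Z))).card ≤
        ((R - 1).choose (t b - used Z)) *
          ∏ b' ∈ Finset.univ.erase b, (Uᶜ.filter (fun w => π w = b')).card.choose
            (t b' - (Z.filter (fun w => π w = b')).card) := by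
    intro t Z
    set W := ∏ b' ∈ Finset.univ.erase b, (Uᶜ.filter (fun w => π w = b')).card.choose
            (t b' - (Z.filter (fun w => π w = b')).card)
    set N := (Finset.univ.filter (fun p : Γ × A => τ p.1 p.2 = t ∧ S p.1 p.2 = Z)).card with hN
    set K := (Finset.univ.filter (fun γ => ((τ γ (g γ), S γ (g γ)) : _ × _) = (t, Z))).card
      with hK
    have hcap : N ≤ R.choose (t b - used Z) * W := by
      have := h.capacity t Z
      rwa [← Finset.mul_prod_erase _ _ (Finset.mem_univ b)] at this
    -- When `used Z` exceeds `t b`, truncated subtraction would give a spurious `choose _ 0`; no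
    -- cell belongs to such a class.
    by_cases hut : used Z ≤ t b
    swap
    · have hN0 : N = 0 := by
        rw [hN, Finset.card_eq_zero, Finset.filter_eq_empty_iff]
        rintro ⟨γ, a⟩ - ⟨h1, h2⟩
        have := hle γ a
        simp only at h1 h2
        rw [h1, h2] at this
        exact hut this
      have hK0 : K = 0 := by
        rw [hK, Finset.card_eq_zero, Finset.filter_eq_empty_iff]
        rintro γ - h12
        have := hle γ (g γ)
        rw [Prod.mk.injEq] at h12
        rw [h12.1, h12.2] at this
        exact hut this
      rw [hN0, hK0]
      simp
    set s := t b - used Z with hs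
    have hsq : (s : ℚ) = (t b : ℚ) - used Z := by rw [hs, Nat.cast_sub hut]
    have hF : (∑ γ, ∑ a, if ((τ γ a, S γ a) : _ × _) = (t, Z) then
        ((τ γ a b : ℚ) - used (S γ a)) / R else 0) = N * (s / R) := by
      rw [← Fintype.sum_prod_type', hN, Finset.card_filter, Nat.cast_sum, Finset.sum_mul]
      refine Finset.sum_congr rfl ?_
      rintro ⟨γ, a⟩ -
      simp only [Prod.mk.injEq]
      split_ifs with h1
      · rw [h1.1, h1.2, hsq]; simp
      · simp
    obtain ⟨hlo, hhi⟩ := hround (t, Z)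
    rw [hF] at hlo hhi
    have hcapq : (N : ℚ) ≤ R.choose s * W := by exact_mod_cast hcap
    constructor
    · rcases Nat.eq_zero_or_pos s with h0 | h0
      · rw [h0] at hhi
        simp only [Nat.cast_zero, zero_div, mul_zero, Nat.ceil_zero] at hhi
        exact hhi.trans (Nat.zero_le _)
      · rw [if_pos (by omega)]
        refine hhi.trans (Nat.ceil_le.2 ?_)
        calc (N : ℚ) * (s / R) ≤ (R.choose s * W) * (s / R) := by gcongr
          _ = (R.choose s * s) / R * W := by ring
          _ = _ := by
            rw [Nat.cast_choose_mul R s h0 hRpos]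
            push_cast
            field_simp
    · rcases Nat.lt_or_ge R s with hRs | hRs
      · have : N = 0 := by
          rw [Nat.choose_eq_zero_of_lt hRs] at hcap
          omega
        rw [this]; simp
      · have h1 : (N : ℚ) - N * (s / R) ≤ ((R - 1).choose s * W : ℕ) := by
          have hRs' : (0 : ℚ) ≤ R - s := sub_nonneg.2 (by exact_mod_cast hRs)
          calc (N : ℚ) - N * (s / R) = N * ((R - s) / R) := by field_simp
            _ ≤ (R.choose s * W) * ((R - s) / R) := by gcongr
            _ = (R.choose s * (R - s)) / R * W := by ring
            _ = _ := by
              rw [Nat.cast_choose_mul_sub R s hRs hRpos]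
              push_cast
              field_simp
        rw [tsub_le_iff_left]
        set B := (R - 1).choose s * W
        rcases Nat.le_total N B with hNB | hNB
        · omega
        · have h2 : ((N - B : ℕ) : ℚ) ≤ N * (s / R) := by
            rw [Nat.cast_sub hNB]; linarith
          have := (Nat.le_floor h2).trans hlo
          omega
  have hprod : ∀ (t : G → ℕ) (Z : Finset V),
      ∏ b', ((insert v U)ᶜ.filter (fun w => π w = b')).card.choose
        (t b' - (Z.filter (fun w => π w = b')).card) =
      (R - 1).choose (t b - used Z) *
          ∏ b' ∈ Finset.univ.erase b, (Uᶜ.filter (fun w => π w = b')).card.choose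
            (t b' - (Z.filter (fun w => π w = b')).card) := by
    intro t Z
    rw [← Finset.mul_prod_erase _ _ (Finset.mem_univ b)]
    congr 1
    · rw [hrem, if_pos rfl]
    · refine Finset.prod_congr rfl fun b' hb' => ?_
      rw [hrem, if_neg (Finset.ne_of_mem_erase hb')]
  refine ⟨fun γ a => if a = g γ then insert v (S γ a) else S γ a, ?_, ?_, ?_, ?_, ?_⟩
  · intro γ a
    split_ifs
    · exact Finset.insert_subset_insert _ (h.subset γ a)
    · exact (h.subset γ a).trans (Finset.subset_insert _ _)
  · intro γ a a' hne
    have hd := h.disjoint γ a a' hne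
    split_ifs with h1 h2 h2
    · exact absurd (h1.trans h2.symm) hne
    · exact Finset.disjoint_insert_left.2 ⟨hvS _ _, hd⟩
    · exact Finset.disjoint_insert_right.2 ⟨hvS _ _, hd⟩
    · exact hd
  · intro γ w hw
    rcases Finset.mem_insert.1 hw with rfl | hw
    · exact ⟨g γ, by simp⟩
    · obtain ⟨a, ha⟩ := h.cover γ w hw
      refine ⟨a, ?_⟩
      split_ifs
      · exact Finset.mem_insert_of_mem ha
      · exact ha
  · intro γ a b'
    split_ifs with h1
    · rw [Finset.filter_insert]
      split_ifs with h2
      · refine (Finset.card_insert_le _ _).trans ?_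
        have h3 : b = b' := h2
        rw [← h3, h1]
        exact hglt γ
      · exact h.card_le γ a b'
    · exact h.card_le γ a b'
  · intro t Z
    by_cases hvZ : v ∈ Z
    · obtain ⟨h1, -⟩ := hcount t (Z.erase v)
      have hZ : insert v (Z.erase v) = Z := Finset.insert_erase hvZ
      have huZ : used Z = used (Z.erase v) + 1 := by
        conv_lhs => rw [← hZ]
        simp only [hused]
        rw [Finset.filter_insert, if_pos hb.symm, Finset.card_insert_of_notMem (by simp)]
      rw [hprod]
      refine le_trans ?_ (h1.trans ?_)
      · refine Finset.card_le_card_of_injOn (fun p => p.1) ?_ ?_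
        · rintro ⟨γ, a⟩ hp
          simp only [Finset.coe_filter, Finset.mem_univ, true_and, Set.mem_ofPred_eq] at hp ⊢
          obtain ⟨hp1, hp2⟩ := hp
          split_ifs at hp2 with ha
          · subst ha
            rw [hp1, ← hp2, Finset.erase_insert (hvS _ _)]
          · rw [← hp2] at hvZ
            exact absurd hvZ (hvS _ _)
        · rintro ⟨γ, a⟩ hp ⟨γ', a'⟩ hp' heq
          simp only [Finset.coe_filter, Finset.mem_univ, true_and, Set.mem_ofPred_eq] at hp hp' heq
          subst heq
          have e1 : a = g γ := by
            by_contra ha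
            rw [if_neg ha] at hp
            exact hvS γ a (hp.2 ▸ hvZ)
          have e2 : a' = g γ := by
            by_contra ha
            rw [if_neg ha] at hp'
            exact hvS γ a' (hp'.2 ▸ hvZ)
          rw [e1, e2]
      · refine Nat.mul_le_mul ?_ (le_of_eq ?_)
        · split_ifs with h2
          · rw [huZ, Nat.sub_sub]
          · exact Nat.zero_le _
        · refine Finset.prod_congr rfl fun b' hb' => ?_
          congr 2
          rw [Finset.filter_erase, Finset.erase_eq_of_notMem]
          simp only [Finset.mem_filter, not_and]
          exact fun _ h2 => Finset.ne_of_mem_erase hb' h2.symm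
    · obtain ⟨-, h2⟩ := hcount t Z
      rw [hprod]
      refine le_trans ?_ h2
      have himg : (Finset.univ.filter (fun γ => ((τ γ (g γ), S γ (g γ)) : _ × _) = (t, Z))).card =
          ((Finset.univ.filter (fun γ => ((τ γ (g γ), S γ (g γ)) : _ × _) = (t, Z))).image
            (fun γ => (γ, g γ))).card := by
        rw [Finset.card_image_of_injective]
        intro γ γ' hh
        exact (Prod.mk.inj hh).1
      rw [himg, ← Finset.card_sdiff_of_subset]
      · refine Finset.card_le_card ?_
        rintro ⟨γ, a⟩ hp
        simp only [Finset.mem_filter, Finset.mem_univ, true_and] at hp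
        obtain ⟨hp1, hp2⟩ := hp
        split_ifs at hp2 with ha
        · exact absurd (hp2 ▸ Finset.mem_insert_self _ _) hvZ
        · simp only [Finset.mem_sdiff, Finset.mem_filter, Finset.mem_univ, true_and,
            Finset.mem_image, not_exists, not_and]
          refine ⟨⟨hp1, hp2⟩, ?_⟩
          intro γ' _ hh
          obtain ⟨rfl, rfl⟩ := Prod.mk.inj hh
          exact ha rfl
      · intro p hp
        obtain ⟨γ, hγ, rfl⟩ := Finset.mem_image.1 hp
        simp only [Finset.mem_filter, Finset.mem_univ, true_and, Prod.mk.injEq] at hγ ⊢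
        exact hγ

/-- A Baranyai-type theorem: a family of multisets of types, each of which adds up to the sizes of
the groups of the ground set, and which together use no type more often than there are sets of that
type, is realised by a family of partitions all of whose parts are distinct. -/
theorem exists_partitions_of_types (hsum : ∀ γ b, ∑ a, τ γ a b =
      (Finset.univ.filter (fun v => π v = b)).card)
    (hcap : ∀ t : G → ℕ, (Finset.univ.filter (fun p : Γ × A => τ p.1 p.2 = t)).card ≤
      ∏ b, (Finset.univ.filter (fun v => π v = b)).card.choose (t b)) :
    ∃ S : Γ → A → Finset V, (∀ γ a a', a ≠ a' → Disjoint (S γ a) (S γ a')) ∧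
      (∀ γ v, ∃ a, v ∈ S γ a) ∧
      (∀ γ a b, ((S γ a).filter (fun v => π v = b)).card = τ γ a b) ∧
      ∀ γ a γ' a', S γ a = S γ' a' → γ = γ' ∧ a = a' := by
  classical
  have hall : ∀ U : Finset V, ∃ S, PartialPartitions π τ U S := by
    intro U
    induction U using Finset.induction_on with
    | empty =>
      refine ⟨fun _ _ => ∅, by simp, by simp, by simp, by simp, ?_⟩
      intro t Z
      by_cases hZ : Z = ∅
      · subst hZ
        simpa using hcap t
      · rw [Finset.filter_false_of_mem]
        · simp
        · rintro p - ⟨-, h2⟩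
          exact hZ h2.symm
    | insert v U hv ih =>
      obtain ⟨S, hS⟩ := ih
      exact hS.step hsum v hv
  obtain ⟨S, hS⟩ := hall Finset.univ
  have hcard : ∀ γ a b, ((S γ a).filter (fun v => π v = b)).card = τ γ a b := by
    intro γ a b
    have h1 := hS.sum_card γ b
    rw [← hsum γ b] at h1
    exact (Finset.sum_eq_sum_iff_of_le (fun a _ => hS.card_le γ a b)).1 h1 a (Finset.mem_univ _)
  refine ⟨S, hS.disjoint, fun γ v => hS.cover γ v (Finset.mem_univ _), hcard, ?_⟩
  intro γ a γ' a' heq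
  have h1 := hS.capacity (τ γ a) (S γ a)
  -- With no element left, every factor is `choose 0 0`, so the capacity invariant says that each
  -- set occurs at most once.
  have h2 : ∏ b, ((Finset.univ : Finset V)ᶜ.filter (fun v => π v = b)).card.choose
        (τ γ a b - ((S γ a).filter (fun v => π v = b)).card) = 1 := by
    refine Finset.prod_eq_one fun b _ => ?_
    rw [hcard]; simp
  rw [h2, Finset.card_le_one] at h1
  have := h1 (γ, a) (by simp) (γ', a') (by
    simp only [Finset.mem_filter, Finset.mem_univ, true_and]
    refine ⟨?_, heq.symm⟩
    ext b
    rw [← hcard, ← hcard, heq])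
  exact Prod.mk.inj this

end

/-! ### From types to Sperner partition systems -/

/-- The groups are the two halves of `Fin n`. Inclusion of parts gives comparable types, which are
then equal; so the sizes agree, the sets coincide, and distinctness of all parts forces the
partitions to be the same. -/
theorem card_le_SP_of_types {n h k : ℕ} (hn : n = 2 * h) (hk : 1 ≤ k) {Γ A : Type*} [Fintype Γ]
    [Fintype A] [DecidableEq Γ] [DecidableEq A] (hA : Fintype.card A = k) (τ : Γ → A → ℕ × ℕ)
    (hfst : ∀ γ, ∑ a, (τ γ a).1 = h) (hsnd : ∀ γ, ∑ a, (τ γ a).2 = h)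
    (hcap : ∀ t : ℕ × ℕ, (Finset.univ.filter (fun p : Γ × A => τ p.1 p.2 = t)).card ≤
      h.choose t.1 * h.choose t.2)
    (hpos : ∀ γ a, 0 < (τ γ a).1 + (τ γ a).2)
    (hinc : ∀ γ a γ' a', τ γ a ≤ τ γ' a' → τ γ a = τ γ' a') :
    Fintype.card Γ ≤ SP n k := by
  classical
  let π : Fin n → Bool := fun v => decide ((v : ℕ) < h)
  have hπt : (Finset.univ.filter (fun v => π v = true)).card = h := by
    have : (Finset.univ.filter (fun v => π v = true)) =
        (Finset.univ.filter (fun v : Fin n => (v : ℕ) < h)) := by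
      ext v; simp [π]
    rw [this, Fin.card_filter_val_lt]
    omega
  have hπf : (Finset.univ.filter (fun v => π v = false)).card = h := by
    have h1 := Finset.card_filter_add_card_filter_not (s := (Finset.univ : Finset (Fin n)))
      (fun v => π v = true)
    simp only [Bool.not_eq_true, Finset.card_univ, Fintype.card_fin] at h1
    omega
  let τ' : Γ → A → Bool → ℕ := fun γ a b => if b then (τ γ a).1 else (τ γ a).2
  obtain ⟨S, hdis, hcov, hcard, hinj⟩ := exists_partitions_of_types (π := π) (τ := τ')
    (by
      intro γ b
      cases b
      · rw [hπf, ← hsnd γ]; simp [τ']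
      · rw [hπt, ← hfst γ]; simp [τ'])
    (by
      intro t
      rw [Fintype.prod_bool, hπt, hπf]
      refine le_trans (Finset.card_le_card ?_) (hcap (t true, t false))
      intro p hp
      simp only [Finset.mem_filter, Finset.mem_univ, true_and] at hp ⊢
      rw [← hp]
      simp [τ'])
  have hne : ∀ γ a, (S γ a).Nonempty := by
    intro γ a
    rw [Finset.nonempty_iff_ne_empty]
    intro h0
    have h1 := hcard γ a true
    have h2 := hcard γ a false
    have h3 := hpos γ a
    simp only [h0, Finset.filter_empty, Finset.card_empty, τ'] at h1 h2
    simp at h1 h2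
    omega
  have hSinj : ∀ γ, Function.Injective (S γ) := fun γ a a' haa => (hinj γ a γ a' haa).2
  let P : Γ → Finpartition (Finset.univ : Finset (Fin n)) := fun γ =>
    { parts := Finset.univ.image (S γ)
      supIndep := by
        rw [Finset.supIndep_iff_pairwiseDisjoint]
        intro X hX Y hY hXY
        obtain ⟨a, -, rfl⟩ := Finset.mem_image.1 hX
        obtain ⟨a', -, rfl⟩ := Finset.mem_image.1 hY
        exact hdis γ a a' (fun haa => hXY (by rw [haa]))
      sup_parts := by
        rw [Finset.sup_image]
        refine le_antisymm (Finset.subset_univ _) fun v _ => ?_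
        obtain ⟨a, ha⟩ := hcov γ v
        exact Finset.mem_sup.2 ⟨a, Finset.mem_univ _, ha⟩
      bot_notMem := by
        intro h0
        obtain ⟨a, -, ha⟩ := Finset.mem_image.1 h0
        exact (hne γ a).ne_empty ha }
  have hP : ∀ γ X, X ∈ (P γ).parts ↔ ∃ a, S γ a = X := by
    intro γ X
    simp [P]
  have hAne : Nonempty A := Fintype.card_pos_iff.1 (by omega)
  have hPinj : Function.Injective P := by
    intro γ γ' hγ
    obtain ⟨a⟩ := hAne
    have : S γ a ∈ (P γ').parts := by
      rw [← hγ, hP]; exact ⟨a, rfl⟩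
    obtain ⟨a', ha'⟩ := (hP _ _).1 this
    exact (hinj _ _ _ _ ha').1.symm
  refine (SP_isGreatest n k).2 ⟨Finset.univ.image P, ⟨?_, ?_⟩, ?_⟩
  · intro Q hQ
    obtain ⟨γ, -, rfl⟩ := Finset.mem_image.1 hQ
    change (Finset.univ.image (S γ)).card = k
    rw [Finset.card_image_of_injective _ (hSinj γ), Finset.card_univ, hA]
  · intro Q hQ Q' hQ' hQQ X hX Y hY hXY
    obtain ⟨γ, -, rfl⟩ := Finset.mem_image.1 hQ
    obtain ⟨γ', -, rfl⟩ := Finset.mem_image.1 hQ'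
    obtain ⟨a, rfl⟩ := (hP _ _).1 hX
    obtain ⟨a', rfl⟩ := (hP _ _).1 hY
    have hle : ∀ b, τ' γ a b ≤ τ' γ' a' b := by
      intro b
      rw [← hcard, ← hcard]
      exact Finset.card_le_card (Finset.filter_subset_filter _ hXY)
    have heq := hinc γ a γ' a' ⟨by simpa [τ'] using hle true, by simpa [τ'] using hle false⟩
    have hc : (S γ' a').card ≤ (S γ a).card := by
      have hh : ∀ γ a, (S γ a).card = (τ γ a).1 + (τ γ a).2 := by
        intro γ a
        have h1 := Finset.card_filter_add_card_filter_not (s := S γ a)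
          (fun v => π v = true)
        simp only [Bool.not_eq_true, hcard] at h1
        simpa [τ'] using h1.symm
      rw [hh, hh, heq]
    have := Finset.eq_of_subset_of_card_le hXY hc
    exact hQQ (by rw [(hinj _ _ _ _ this).1])
  · rw [Finset.card_image_of_injective _ hPinj, Finset.card_univ]

/-! ### Zero-sum triples with unimodal marginals -/

/-- Together with `l ↦ l - R`, this enumerates `{-R, …, R}` so that the sums of corresponding terms
also enumerate `{-R, …, R}`. -/
def mixSnd (R l : ℕ) : ℤ := if l % 2 = 0 then -((l / 2 : ℕ) : ℤ) else (R : ℤ) - (l / 2 : ℕ)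

theorem mixSnd_bounds {R l : ℕ} (h : l < 2 * R + 1) :
    -(R : ℤ) ≤ mixSnd R l ∧ mixSnd R l ≤ R ∧
      -(R : ℤ) ≤ ((l : ℤ) - R) + mixSnd R l ∧ ((l : ℤ) - R) + mixSnd R l ≤ R := by
  unfold mixSnd
  split_ifs <;> omega

theorem mixSnd_inj {R l l' : ℕ} (h : l < 2 * R + 1) (h' : l' < 2 * R + 1)
    (he : mixSnd R l = mixSnd R l') : l = l' := by
  unfold mixSnd at he
  split_ifs at he <;> omega

theorem add_mixSnd_inj {R l l' : ℕ} (h : l < 2 * R + 1) (h' : l' < 2 * R + 1)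
    (he : ((l : ℤ) - R) + mixSnd R l = ((l' : ℤ) - R) + mixSnd R l') : l = l' := by
  unfold mixSnd at he
  split_ifs at he <;> omega

/-- Truncated telescoping; the `if` term is the remaining tail, kept so that the induction closes.
-/
theorem sum_sub_succ_le {w : ℕ → ℕ} (hw : Antitone w) (a N : ℕ) :
    ∑ R ∈ (Finset.range N).filter (a ≤ ·), (w R - w (R + 1)) +
      (if a ≤ N then w N else w a) ≤ w a := by
  induction N with
  | zero => simp; split_ifs <;> simp_all
  | succ N ih =>
    rw [Finset.range_add_one, Finset.filter_insert]
    have h1 := hw (Nat.le_succ N)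
    rcases lt_trichotomy a (N + 1) with h | h | h
    · rw [if_pos (by omega), Finset.sum_insert (by simp), if_pos (by omega)]
      rw [if_pos (by omega)] at ih
      simp only [Nat.succ_eq_add_one] at h1
      omega
    · subst h
      rw [if_neg (by omega), if_pos le_rfl]
      rw [if_neg (by omega)] at ih
      exact ih
    · rw [if_neg (by omega), if_neg (by omega)]
      rw [if_neg (by omega)] at ih
      exact ih

/-- Summation by parts: the uniform layers on `{-R, …, R}` together have the mass of the symmetric
extension of `w`. -/
theorem sum_sub_succ_mul {w : ℕ → ℕ} (hw : Antitone w) (N : ℕ) :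
    ∑ R ∈ Finset.range N, (w R - w (R + 1)) * (2 * R + 1) + 2 * N * w N + w 0 =
      2 * ∑ R ∈ Finset.range N, w R + w N := by
  induction N with
  | zero => simp
  | succ N ih =>
    rw [Finset.sum_range_succ, Finset.sum_range_succ]
    obtain ⟨d, hd⟩ := Nat.exists_eq_add_of_le (hw (Nat.le_succ N))
    simp only [Nat.succ_eq_add_one] at hd
    rw [hd] at ih ⊢
    rw [Nat.add_sub_cancel_left]
    linarith

/-- A symmetric unimodal distribution on the integers is the common marginal of a distribution of
triples of integers with sum zero. -/
theorem exists_triples_sum_zero {w : ℕ → ℕ} (hw : Antitone w) {N : ℕ} (hN : w N = 0) :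
    ∃ (Γ : Type) (_ : Fintype Γ) (_ : DecidableEq Γ) (x y z : Γ → ℤ),
      (∀ γ, x γ + y γ + z γ = 0) ∧
      (∀ i, (Finset.univ.filter (fun γ => x γ = i)).card ≤ w i.natAbs) ∧
      (∀ i, (Finset.univ.filter (fun γ => y γ = i)).card ≤ w i.natAbs) ∧
      (∀ i, (Finset.univ.filter (fun γ => z γ = i)).card ≤ w i.natAbs) ∧
      Fintype.card Γ + w 0 = 2 * ∑ r ∈ Finset.range N, w r := by
  -- For a fixed layer and copy, at most one `l` gives the value `i`, and only layers `R ≥ |i|` can;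
  -- their multiplicities telescope to at most `w |i|`.
  have key : ∀ (f : ℕ → ℕ → ℤ), (∀ R l : ℕ, l < 2 * R + 1 → -(R : ℤ) ≤ f R l ∧ f R l ≤ R) →
      (∀ R l l' : ℕ, l < 2 * R + 1 → l' < 2 * R + 1 → f R l = f R l' → l = l') → ∀ i : ℤ,
      (Finset.univ.filter (fun γ : Σ R : Fin N, Fin (w R - w (R + 1)) × Fin (2 * R + 1) =>
        f γ.1 γ.2.2 = i)).card ≤ w i.natAbs := by
    intro f hb hinj i
    have h1 : (Finset.univ.filter (fun γ : Σ R : Fin N, Fin (w R - w (R + 1)) × Fin (2 * R + 1) =>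
        f γ.1 γ.2.2 = i)).card ≤
        ((Finset.univ.filter (fun R : Fin N => i.natAbs ≤ (R : ℕ))).sigma
          (fun R => (Finset.univ : Finset (Fin (w R - w (R + 1)))))).card := by
      refine Finset.card_le_card_of_injOn (fun γ => ⟨γ.1, γ.2.1⟩) ?_ ?_
      · rintro ⟨R, c, l⟩ h
        simp only [Finset.coe_filter, Finset.mem_univ, true_and, Set.mem_ofPred_eq] at h
        have := hb R l l.2
        simp only [Finset.coe_sigma, Set.mem_sigma_iff, Finset.coe_filter, Finset.mem_univ,
          true_and, Set.mem_ofPred_eq, Finset.coe_univ, Set.mem_univ, and_true]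
        omega
      · rintro ⟨R, c, l⟩ h ⟨R', c', l'⟩ h' he
        simp only [Finset.coe_filter, Finset.mem_univ, true_and, Set.mem_ofPred_eq] at h h'
        simp only [Sigma.mk.injEq] at he
        obtain ⟨rfl, he⟩ := he
        obtain rfl := eq_of_heq he
        have : l = l' := Fin.ext (hinj R l l' l.2 l'.2 (h.trans h'.symm))
        rw [this]
    refine h1.trans ?_
    rw [Finset.card_sigma]
    simp only [Finset.card_univ, Fintype.card_fin]
    rw [Finset.sum_filter, Fin.sum_univ_eq_sum_range
      (fun R => if i.natAbs ≤ R then w R - w (R + 1) else 0), ← Finset.sum_filter]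
    exact le_trans (Nat.le_add_right _ _) (sum_sub_succ_le hw i.natAbs N)
  -- `w` is the sum over `R` of `w R - w (R + 1)` uniform weights on `{-R, …, R}`; for each of them
  -- `l` runs through one coupling.
  refine ⟨Σ R : Fin N, Fin (w R - w (R + 1)) × Fin (2 * R + 1), inferInstance, inferInstance,
    fun γ => ((γ.2.2 : ℕ) : ℤ) - ((γ.1 : ℕ) : ℤ), fun γ => mixSnd γ.1 γ.2.2,
    fun γ => -((((γ.2.2 : ℕ) : ℤ) - ((γ.1 : ℕ) : ℤ)) + mixSnd γ.1 γ.2.2), ?_, ?_, ?_, ?_, ?_⟩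
  · intro γ; ring
  · exact key (fun R l => (l : ℤ) - R) (fun R l h => by constructor <;> omega)
      (fun R l l' _ _ h => by omega)
  · exact key mixSnd (fun R l h => ⟨(mixSnd_bounds h).1, (mixSnd_bounds h).2.1⟩)
      (fun R l l' h h' he => mixSnd_inj h h' he)
  · refine key (fun R l => -(((l : ℤ) - R) + mixSnd R l)) (fun R l h => ?_)
      (fun R l l' h h' he => add_mixSnd_inj h h' (neg_injective he))
    have := mixSnd_bounds h
    constructor <;> linarith [this.2.2.1, this.2.2.2]
  · have := sum_sub_succ_mul hw N
    rw [hN] at this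
    rw [Fintype.card_sigma]
    simp only [Fintype.card_prod, Fintype.card_fin]
    rw [Fin.sum_univ_eq_sum_range (fun R => (w R - w (R + 1)) * (2 * R + 1))]
    simpa using this

/-! ### Triples with separated residues -/

theorem Int.eq_and_eq_of_mul_add_eq {x x' Q A A' : ℤ} (h : x * Q + A = x' * Q + A')
    (h1 : A - A' < Q) (h2 : A' - A < Q) : x = x' ∧ A = A' := by
  have h3 : A - A' = 0 := by
    refine Int.eq_zero_of_abs_lt_dvd (m := Q) ⟨x' - x, by linarith⟩ ?_
    rw [abs_lt]
    constructor <;> linarith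
  have hQ : 0 < Q := by linarith
  refine ⟨?_, by linarith⟩
  have h4 : (x - x') * Q = 0 := by linarith
  rcases mul_eq_zero.1 h4 with h | h
  · linarith
  · exact absurd h hQ.ne'

/-- The integer `j * Q + P + b + 1` belongs to neither kind of interval; this gap of one keeps `v +
1` away from the next `u`-interval as well. -/
theorem residues_separated {i j Q P b u v : ℤ} (hQ0 : 0 ≤ Q) (hQ : Q = P + 2 * b + 2)
    (hu : i * Q - b ≤ u ∧ u ≤ i * Q + b) (hv : j * Q + b + 1 ≤ v ∧ v ≤ j * Q + P + b)
    (h : v ≤ u ∧ u ≤ v + 1) : False := by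
  rcases le_or_gt i j with hij | hij
  · have := mul_le_mul_of_nonneg_right hij hQ0
    linarith [hu.2, hv.1, h.1]
  · have : (j + 1) * Q ≤ i * Q := mul_le_mul_of_nonneg_right hij hQ0
    linarith [hu.1, hv.2, h.2]

/-- Triples `(u, v₁, v₂)` with `u + v₁ + v₂ + 1 = 0` in which `u` lies in short intervals around the
multiples of `Q = (2 b + 1) L + 2 b + 2`, and `v₁`, `v₂` lie in the complementary intervals. -/
theorem exists_separated_triples {w : ℕ → ℕ} (hw : Antitone w) {N : ℕ} (hN : w N = 0)
    (b L : ℕ) (Q : ℤ) (hQ : Q = (2 * b + 1) * L + 2 * b + 2) :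
    ∃ (Γ : Type) (_ : Fintype Γ) (_ : DecidableEq Γ) (u v₁ v₂ : Γ → ℤ),
      (∀ γ, u γ + v₁ γ + v₂ γ + 1 = 0) ∧
      (∀ γ, ∃ i : ℤ, i * Q - b ≤ u γ ∧ u γ ≤ i * Q + b) ∧
      (∀ γ, ∃ j : ℤ, j * Q + b + 1 ≤ v₁ γ ∧ v₁ γ ≤ j * Q + (2 * b + 1) * L + b) ∧
      (∀ γ, ∃ j : ℤ, j * Q + b + 1 ≤ v₂ γ ∧ v₂ γ ≤ j * Q + (2 * b + 1) * L + b) ∧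
      (∀ γ, ∃ i : ℕ, |u γ| ≤ (i + 1) * Q ∧ w i ≠ 0 ∧
        (Finset.univ.filter (fun γ' => u γ' = u γ)).card ≤ L * w i) ∧
      (∀ γ, ∃ i : ℕ, |v₁ γ| ≤ (i + 1) * Q ∧ w i ≠ 0 ∧
        (Finset.univ.filter (fun γ' => v₁ γ' = v₁ γ)).card ≤ w i) ∧
      (∀ γ, ∃ i : ℕ, |v₂ γ| ≤ (i + 1) * Q ∧ w i ≠ 0 ∧
        (Finset.univ.filter (fun γ' => v₂ γ' = v₂ γ)).card ≤ w i) ∧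
      Fintype.card Γ + (2 * b + 1) * L * w 0 =
        (2 * b + 1) * L * (2 * ∑ r ∈ Finset.range N, w r) := by
  obtain ⟨Γ, _, _, x, y, z, hsum, hx, hy, hz, hcard⟩ := exists_triples_sum_zero hw hN
  have hne : ∀ (f : Γ → ℤ), (∀ i, (Finset.univ.filter (fun γ => f γ = i)).card ≤ w i.natAbs) →
      ∀ γ, w (f γ).natAbs ≠ 0 := by
    intro f hf γ h0
    have h1 := hf (f γ)
    rw [h0, Nat.le_zero, Finset.card_eq_zero] at h1
    exact Finset.notMem_empty γ (h1 ▸ (by simp : γ ∈ Finset.univ.filter (fun γ' => f γ' = f γ)))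
  set P : ℤ := (2 * b + 1) * L with hP
  have hσ : ∀ a : Fin L, (2 * b + 1 : ℤ) ≤ (2 * b + 1) * ((a : ℕ) + 1) ∧
      (2 * b + 1 : ℤ) * ((a : ℕ) + 1) ≤ P := by
    intro a
    have h1 : ((a : ℕ) : ℤ) + 1 ≤ L := by exact_mod_cast a.2
    constructor
    · nlinarith [Int.natCast_nonneg (a : ℕ), Int.natCast_nonneg b]
    · exact mul_le_mul_of_nonneg_left h1 (by positivity)
  have hP0 : 0 ≤ P := by positivity
  have hab : ∀ (f : ℤ) (c : ℤ), |c| ≤ Q → |f * Q + c| ≤ ((f.natAbs : ℕ) + 1) * Q := by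
    intro f c hc
    have hQ0 : 0 ≤ Q := by linarith [Int.natCast_nonneg b]
    calc |f * Q + c| ≤ |f * Q| + |c| := abs_add_le _ _
      _ ≤ |f| * Q + Q := by rw [abs_mul, abs_of_nonneg hQ0]; linarith
      _ = _ := by rw [Int.natCast_natAbs]; ring
  have hcancel : ∀ {a a' : Fin L} {β β' : ℤ},
      (2 * b + 1 : ℤ) * ((a : ℕ) + 1) + β = (2 * b + 1) * ((a' : ℕ) + 1) + β' →
      -(b : ℤ) ≤ β → β ≤ b → -(b : ℤ) ≤ β' → β' ≤ b → a = a' ∧ β = β' := by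
    intro a a' β β' h h1 h2 h3 h4
    have := Int.eq_and_eq_of_mul_add_eq (x := (a : ℕ) + 1) (x' := (a' : ℕ) + 1) (Q := 2 * b + 1)
      (A := β) (A' := β') (by linarith) (by linarith) (by linarith)
    refine ⟨Fin.ext ?_, this.2⟩
    have := this.1
    omega
  -- The zero-sum triple gives the blocks. The offsets couple `{-b, …, b}` with itself, shifted by
  -- the centres `(2 b + 1)(a + 1)`, which tile the long interval. The value of `u` leaves `a` free,
  -- whence its multiplicity `L`; those of `v₁` and `v₂` determine both `l` and `a`.
  refine ⟨Γ × Fin (2 * b + 1) × Fin L, inferInstance, inferInstance,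
    fun γ => x γ.1 * Q + (((γ.2.1 : ℕ) : ℤ) - b),
    fun γ => y γ.1 * Q + ((2 * b + 1) * ((γ.2.2 : ℕ) + 1) + mixSnd b γ.2.1),
    fun γ => z γ.1 * Q - ((2 * b + 1) * ((γ.2.2 : ℕ) + 1) + 1 +
      ((((γ.2.1 : ℕ) : ℤ) - b) + mixSnd b γ.2.1)), ?_, ?_, ?_, ?_, ?_, ?_, ?_, ?_⟩
  · rintro ⟨γ, l, a⟩
    have := hsum γ
    have h2 : z γ = - x γ - y γ := by linarith
    simp only [h2]
    ring
  · rintro ⟨γ, l, a⟩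
    refine ⟨x γ, ?_, ?_⟩ <;> have := l.2 <;> dsimp only <;> linarith
  · rintro ⟨γ, l, a⟩
    have h1 := mixSnd_bounds l.2
    have h2 := hσ a
    refine ⟨y γ, ?_, ?_⟩ <;> dsimp only <;> linarith [h1.1, h1.2.1, h2.1, h2.2]
  · rintro ⟨γ, l, a⟩
    have h1 := mixSnd_bounds l.2
    have h2 := hσ a
    -- The offset is subtracted here, so `v₂` lies in the block below `z γ`.
    refine ⟨z γ - 1, ?_, ?_⟩ <;> dsimp only <;>
      linarith [h1.2.2.1, h1.2.2.2, h2.1, h2.2]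
  · rintro ⟨γ, l, a⟩
    have hl := l.2
    refine ⟨(x γ).natAbs, hab _ _ ?_, hne x hx γ, ?_⟩
    · rw [abs_le]; constructor <;> dsimp only <;> linarith
    · calc _ ≤ ((Finset.univ.filter (fun γ' => x γ' = x γ)) ×ˢ (Finset.univ : Finset (Fin L))).card := by
            have huniq : ∀ p : Γ × Fin (2 * b + 1) × Fin L,
                x p.1 * Q + (((p.2.1 : ℕ) : ℤ) - b) = x γ * Q + (((l : ℕ) : ℤ) - b) →
                x p.1 = x γ ∧ p.2.1 = l := by
              intro p hp
              have hpl := p.2.1.2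
              have := Int.eq_and_eq_of_mul_add_eq hp (by linarith) (by linarith)
              refine ⟨this.1, Fin.ext ?_⟩
              have := this.2
              omega
            refine Finset.card_le_card_of_injOn (fun p => (p.1, p.2.2)) ?_ ?_
            · intro p hp
              have := huniq p (by simpa using hp)
              simp [this.1]
            · intro p hp p' hp' he
              have h1 := huniq p (by simpa using hp)
              have h2 := huniq p' (by simpa using hp')
              simp only [Prod.mk.injEq] at he
              exact Prod.ext he.1 (Prod.ext (h1.2.trans h2.2.symm) he.2)
        _ ≤ _ := by
          rw [Finset.card_product, Finset.card_univ, Fintype.card_fin, mul_comm]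
          exact Nat.mul_le_mul_left _ (hx _)
  · rintro ⟨γ, l, a⟩
    have h1 := mixSnd_bounds l.2
    have h2 := hσ a
    refine ⟨(y γ).natAbs, hab _ _ ?_, hne y hy γ, ?_⟩
    · rw [abs_le]; constructor <;> dsimp only <;> linarith [h1.1, h1.2.1, h2.1, h2.2]
    · refine le_trans ?_ (hy (y γ))
      have huniq : ∀ p : Γ × Fin (2 * b + 1) × Fin L,
          y p.1 * Q + ((2 * b + 1) * ((p.2.2 : ℕ) + 1) + mixSnd b p.2.1) =
            y γ * Q + ((2 * b + 1) * ((a : ℕ) + 1) + mixSnd b l) →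
          y p.1 = y γ ∧ p.2.1 = l ∧ p.2.2 = a := by
        intro p hp
        have h3 := mixSnd_bounds p.2.1.2
        have h4 := hσ p.2.2
        have := Int.eq_and_eq_of_mul_add_eq hp
          (by linarith [h1.1, h1.2.1, h2.1, h2.2, h3.1, h3.2.1, h4.1, h4.2])
          (by linarith [h1.1, h1.2.1, h2.1, h2.2, h3.1, h3.2.1, h4.1, h4.2])
        have h5 := hcancel this.2 h3.1 h3.2.1 h1.1 h1.2.1
        exact ⟨this.1, Fin.ext (mixSnd_inj p.2.1.2 l.2 h5.2), h5.1⟩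
      refine Finset.card_le_card_of_injOn (fun p => p.1) ?_ ?_
      · intro p hp
        have := huniq p (by simpa using hp)
        simp [this.1]
      · intro p hp p' hp' he
        have h5 := huniq p (by simpa using hp)
        have h6 := huniq p' (by simpa using hp')
        exact Prod.ext he (Prod.ext (h5.2.1.trans h6.2.1.symm) (h5.2.2.trans h6.2.2.symm))
  · rintro ⟨γ, l, a⟩
    have h1 := mixSnd_bounds l.2
    have h2 := hσ a
    refine ⟨(z γ).natAbs, ?_, hne z hz γ, ?_⟩
    · dsimp only
      rw [sub_eq_add_neg]
      refine hab _ _ ?_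
      rw [abs_le]
      constructor <;> linarith [h1.2.2.1, h1.2.2.2, h2.1, h2.2]
    · refine le_trans ?_ (hz (z γ))
      have huniq : ∀ p : Γ × Fin (2 * b + 1) × Fin L,
          z p.1 * Q - ((2 * b + 1) * ((p.2.2 : ℕ) + 1) + 1 +
            ((((p.2.1 : ℕ) : ℤ) - b) + mixSnd b p.2.1)) =
          z γ * Q - ((2 * b + 1) * ((a : ℕ) + 1) + 1 + ((((l : ℕ) : ℤ) - b) + mixSnd b l)) →
          z p.1 = z γ ∧ p.2.1 = l ∧ p.2.2 = a := by
        intro p hp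
        have h3 := mixSnd_bounds p.2.1.2
        have h4 := hσ p.2.2
        rw [sub_eq_add_neg, sub_eq_add_neg] at hp
        have := Int.eq_and_eq_of_mul_add_eq hp
          (by linarith [h1.2.2.1, h1.2.2.2, h2.1, h2.2, h3.2.2.1, h3.2.2.2, h4.1, h4.2])
          (by linarith [h1.2.2.1, h1.2.2.2, h2.1, h2.2, h3.2.2.1, h3.2.2.2, h4.1, h4.2])
        have h5 := hcancel (a := p.2.2) (a' := a) (by linarith [this.2])
          h3.2.2.1 h3.2.2.2 h1.2.2.1 h1.2.2.2
        exact ⟨this.1, Fin.ext (add_mixSnd_inj p.2.1.2 l.2 h5.2), h5.1⟩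
      refine Finset.card_le_card_of_injOn (fun p => p.1) ?_ ?_
      · intro p hp
        have := huniq p (by simpa using hp)
        simp [this.1]
      · intro p hp p' hp' he
        have h5 := huniq p (by simpa using hp)
        have h6 := huniq p' (by simpa using hp')
        exact Prod.ext he (Prod.ext (h5.2.1.trans h6.2.1.symm) (h5.2.2.trans h6.2.2.symm))
  · simp only [Fintype.card_prod, Fintype.card_fin]
    rw [← hcard]
    ring

/-! ### The construction from unimodal weights -/

theorem card_filter_prod_eq_sum {Γ A : Type*} [Fintype Γ] [Fintype A] (p : Γ → A → Prop)
    [∀ γ a, Decidable (p γ a)] :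
    (Finset.univ.filter (fun x : Γ × A => p x.1 x.2)).card =
      ∑ a, (Finset.univ.filter (fun γ => p γ a)).card := by
  simp only [Finset.card_filter]
  rw [Fintype.sum_prod_type_right]

/-- The construction: unimodal weights `w` that respect the capacities of the types
`(m' + u, m' - u)` and `(m + 1 + v, m - v)` yield a Sperner partition system. -/
theorem le_SP_of_weights {n h k m m' t b L N Q : ℕ} {w : ℕ → ℕ} (hw : Antitone w) (hN : w N = 0)
    (ht : 1 ≤ t) (hk : k = 2 * t + 1) (hn : n = 2 * h) (hm' : m' = m ∨ m' = m + 1)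
    (hh : h = m' + t * (2 * m + 1)) (hQ : Q = (2 * b + 1) * L + 2 * b + 2)
    (hrange : ∀ i, w i ≠ 0 → (i + 1) * Q ≤ m)
    (hE : ∀ i, w i ≠ 0 → ∀ u ≤ (i + 1) * Q, L * w i ≤ h.choose (m' + u) * h.choose (m' - u))
    (hD : ∀ i, w i ≠ 0 → ∀ v ≤ (i + 1) * Q,
      2 * t * w i ≤ h.choose (m + 1 + v) * h.choose (m - v)) :
    (2 * b + 1) * L * (2 * ∑ r ∈ Finset.range N, w r) ≤ SP n k + (2 * b + 1) * L * w 0 := by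
  obtain ⟨Γ, _, _, u, v₁, v₂, hsum, hu, hv₁, hv₂, hcu, hc₁, hc₂, hcard⟩ :=
    exists_separated_triples hw hN b L Q (by rw [hQ]; push_cast; ring)
  rw [← hcard]
  refine Nat.add_le_add_right ?_ _
  obtain ⟨t, rfl⟩ : ∃ s, t = s + 1 := ⟨t - 1, by omega⟩
  -- bounds on the coordinates
  have hrange' : ∀ i, w i ≠ 0 → ((i : ℤ) + 1) * Q ≤ m := fun i hi => by
    exact_mod_cast hrange i hi
  have hbu : ∀ γ, -(m : ℤ) ≤ u γ ∧ u γ ≤ m := by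
    intro γ
    obtain ⟨i, hi, hi', -⟩ := hcu γ
    exact abs_le.1 (hi.trans (hrange' i hi'))
  have hb₁ : ∀ γ, -(m : ℤ) ≤ v₁ γ ∧ v₁ γ ≤ m := by
    intro γ
    obtain ⟨i, hi, hi', -⟩ := hc₁ γ
    exact abs_le.1 (hi.trans (hrange' i hi'))
  have hb₂ : ∀ γ, -(m : ℤ) ≤ v₂ γ ∧ v₂ γ ≤ m := by
    intro γ
    obtain ⟨i, hi, hi', -⟩ := hc₂ γ
    exact abs_le.1 (hi.trans (hrange' i hi'))
  have hm0 : ∀ _ : Γ, 1 ≤ m := by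
    intro γ
    obtain ⟨i, -, hi', -⟩ := hcu γ
    have := hrange i hi'
    nlinarith
  -- capacities
  have hE' : ∀ i, w i ≠ 0 → ∀ s : ℤ, |s| ≤ (i + 1) * Q →
      L * w i ≤ h.choose (m' + s).toNat * h.choose (m' - s).toNat := by
    intro i hi s hs
    obtain ⟨a, rfl | rfl⟩ := Int.eq_nat_or_neg s
    · rw [Nat.abs_cast] at hs
      have := hE i hi a (by exact_mod_cast hs)
      rwa [show ((m' : ℤ) + a).toNat = m' + a by omega,
        show ((m' : ℤ) - a).toNat = m' - a by omega]
    · rw [abs_neg, Nat.abs_cast] at hs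
      have := hE i hi a (by exact_mod_cast hs)
      rwa [show ((m' : ℤ) + -a).toNat = m' - a by omega,
        show ((m' : ℤ) - -a).toNat = m' + a by omega, mul_comm (h.choose _)]
  have hD' : ∀ i, w i ≠ 0 → ∀ s : ℤ, |s| ≤ (i + 1) * Q →
      2 * (t + 1) * w i ≤ h.choose (m + 1 + s).toNat * h.choose (m - s).toNat := by
    intro i hi s hs
    rcases le_or_gt 0 s with h0 | h0
    · obtain ⟨a, rfl⟩ := Int.eq_ofNat_of_zero_le h0
      rw [abs_of_nonneg h0] at hs
      have := hD i hi a (by exact_mod_cast hs)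
      rwa [show ((m : ℤ) + 1 + a).toNat = m + 1 + a by omega,
        show ((m : ℤ) - a).toNat = m - a by omega]
    -- The reflection `s ↦ -1 - s` exchanges the two coordinates of the type.
    · obtain ⟨a, ha⟩ := Int.eq_ofNat_of_zero_le (show 0 ≤ -1 - s by omega)
      obtain rfl : s = -1 - a := by omega
      rw [abs_of_neg h0] at hs
      have hs' : (a : ℤ) ≤ ((i + 1) * Q : ℕ) := by push_cast; linarith
      have := hD i hi a (by exact_mod_cast hs')
      rwa [show ((m : ℤ) + 1 + (-1 - a)).toNat = m - a by omega,
        show ((m : ℤ) - (-1 - a)).toNat = m + 1 + a by omega, mul_comm (h.choose _)]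
  let e : ℤ → ℕ × ℕ := fun s => ((m' + s).toNat, (m' - s).toNat)
  let d : ℤ → ℕ × ℕ := fun s => ((m + 1 + s).toNat, (m - s).toNat)
  -- The pair `j = 0` is `(v₁, v₂)`, which balances `u`; every other pair is `(v₁, -1 - v₁)`, whose
  -- types add up to `(2 m + 1, 2 m + 1)`.
  let val : Γ → Unit ⊕ (Fin (t + 1) × Bool) → ℤ := fun γ a =>
    match a with
    | Sum.inl _ => u γ
    | Sum.inr (j, true) => v₁ γ
    | Sum.inr (j, false) => if j = 0 then v₂ γ else -1 - v₁ γ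
  let τ : Γ → Unit ⊕ (Fin (t + 1) × Bool) → ℕ × ℕ := fun γ a =>
    match a with
    | Sum.inl _ => e (val γ a)
    | Sum.inr _ => d (val γ a)
  have hval : ∀ γ x, (-(m : ℤ) - 1 ≤ val γ (Sum.inr x) ∧ val γ (Sum.inr x) ≤ m) ∧
      ∃ j : ℤ, j * Q + b + 1 ≤ val γ (Sum.inr x) ∧
        val γ (Sum.inr x) ≤ j * Q + (2 * b + 1) * L + b := by
    rintro γ ⟨j, _ | _⟩
    · simp only [val]
      split_ifs
      · exact ⟨⟨by linarith [(hb₂ γ).1], (hb₂ γ).2⟩, hv₂ γ⟩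
      · refine ⟨⟨by linarith [(hb₁ γ).2], by linarith [(hb₁ γ).1]⟩, ?_⟩
        obtain ⟨j, h1, h2⟩ := hv₁ γ
        refine ⟨-j - 1, ?_, ?_⟩ <;> push_cast [hQ] at h1 h2 ⊢ <;> linarith
    · exact ⟨⟨by linarith [(hb₁ γ).1], (hb₁ γ).2⟩, hv₁ γ⟩
  -- For either value of `m'`, this is the only way an `e`-type and a `d`-type can be comparable.
  have hsep : ∀ γ γ' x, ¬ (val γ' (Sum.inr x) ≤ u γ ∧ u γ ≤ val γ' (Sum.inr x) + 1) := by
    intro γ γ' x hx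
    obtain ⟨i, hi⟩ := hu γ
    obtain ⟨-, j, hj⟩ := hval γ' x
    exact residues_separated (P := (2 * b + 1) * L) (by positivity) (by push_cast [hQ]; ring)
      hi hj hx
  refine card_le_SP_of_types (h := h) hn (by omega) (A := Unit ⊕ (Fin (t + 1) × Bool))
    (by simp only [Fintype.card_sum, Fintype.card_unit, Fintype.card_prod, Fintype.card_fin,
          Fintype.card_bool]; omega) τ ?_ ?_ ?_ ?_ ?_
  · intro γ
    have h1 := hsum γ
    have hu' := hbu γ
    have h1' := hb₁ γ
    have h2' := hb₂ γ
    have hmm := hm0 γ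
    rw [Fintype.sum_sum_type, Fintype.sum_prod_type]
    simp only [Fintype.sum_bool, Finset.univ_unique, Finset.sum_singleton]
    rw [Fin.sum_univ_succ]
    simp only [τ, e, d, val, if_true, Fin.succ_ne_zero, if_false, Finset.sum_const,
      Finset.card_univ, Fintype.card_fin, smul_eq_mul]
    rw [show (↑m + 1 + v₁ γ).toNat + (↑m + 1 + (-1 - v₁ γ)).toNat = 2 * m + 1 by omega, hh,
      add_mul, one_mul]
    omega
  · intro γ
    have h1 := hsum γ
    have hu' := hbu γ
    have h1' := hb₁ γ
    have h2' := hb₂ γ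
    have hmm := hm0 γ
    rw [Fintype.sum_sum_type, Fintype.sum_prod_type]
    simp only [Fintype.sum_bool, Finset.univ_unique, Finset.sum_singleton]
    rw [Fin.sum_univ_succ]
    simp only [τ, e, d, val, if_true, Fin.succ_ne_zero, if_false, Finset.sum_const,
      Finset.card_univ, Fintype.card_fin, smul_eq_mul]
    rw [show (↑m - v₁ γ).toNat + (↑m - (-1 - v₁ γ)).toNat = 2 * m + 1 by omega, hh,
      add_mul, one_mul]
    omega
  · intro s
    rw [card_filter_prod_eq_sum (fun γ a => τ γ a = s), Fintype.sum_sum_type,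
      Fintype.sum_prod_type]
    simp only [Fintype.sum_bool, Finset.univ_unique, Finset.sum_singleton]
    rw [Fin.sum_univ_succ]
    simp only [τ, val, if_true, Fin.succ_ne_zero, if_false, Finset.sum_const,
      Finset.card_univ, Fintype.card_fin, smul_eq_mul]
    set C := h.choose s.1 * h.choose s.2
    have hEcount : (Finset.univ.filter (fun γ => e (u γ) = s)).card ≤ C ∧
        ((Finset.univ.filter (fun γ => e (u γ) = s)).card ≠ 0 → s.1 + s.2 = 2 * m') := by
      rcases Finset.eq_empty_or_nonempty (Finset.univ.filter (fun γ => e (u γ) = s)) with h0 | h0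
      · rw [h0]; simp
      · obtain ⟨γ, hγ⟩ := h0
        have hγ : e (u γ) = s := by simpa using hγ
        have hbγ := hbu γ
        refine ⟨?_, fun _ => by rw [← hγ]; simp only [e]; omega⟩
        obtain ⟨i, hi, hi', hi''⟩ := hcu γ
        refine le_trans (Finset.card_le_card ?_) (hi''.trans ?_)
        · intro γ' hγ'
          simp only [Finset.mem_filter, Finset.mem_univ, true_and] at hγ' ⊢
          have hbγ' := hbu γ'
          rw [← hγ, Prod.ext_iff] at hγ'
          simp only [e] at hγ'
          omega
        · have := hE' i hi' _ hi
          simp only [C, ← hγ]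
          exact this
    -- A type of odd size may appear at any of the `2 * (t + 1)` odd positions, so each position is
    -- allowed that fraction of the capacity.
    have hDcount : ∀ f : Γ → ℤ, (∀ γ, -(m : ℤ) - 1 ≤ f γ ∧ f γ ≤ m) →
        (∀ γ, ∃ i : ℕ, w i ≠ 0 ∧
          2 * (t + 1) * w i ≤ h.choose (m + 1 + f γ).toNat * h.choose (m - f γ).toNat ∧
          (Finset.univ.filter (fun γ' => f γ' = f γ)).card ≤ w i) →
        2 * (t + 1) * (Finset.univ.filter (fun γ => d (f γ) = s)).card ≤ C ∧
        ((Finset.univ.filter (fun γ => d (f γ) = s)).card ≠ 0 → s.1 + s.2 = 2 * m + 1) := by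
      intro f hf hc
      rcases Finset.eq_empty_or_nonempty (Finset.univ.filter (fun γ => d (f γ) = s)) with h0 | h0
      · rw [h0]; simp
      · obtain ⟨γ, hγ⟩ := h0
        have hγ : d (f γ) = s := by simpa using hγ
        have hbγ := hf γ
        refine ⟨?_, fun _ => by rw [← hγ]; simp only [d]; omega⟩
        obtain ⟨i, hi', hi, hi''⟩ := hc γ
        refine le_trans (Nat.mul_le_mul_left _ ((Finset.card_le_card ?_).trans hi'')) ?_
        · intro γ' hγ'
          simp only [Finset.mem_filter, Finset.mem_univ, true_and] at hγ' ⊢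
          have hbγ' := hf γ'
          rw [← hγ, Prod.ext_iff] at hγ'
          simp only [d] at hγ'
          omega
        · simp only [C, ← hγ]
          exact hi
    have hD1 := hDcount v₁ (fun γ => ⟨by linarith [(hb₁ γ).1], (hb₁ γ).2⟩) (fun γ => by
      obtain ⟨i, hi, hi', hi''⟩ := hc₁ γ
      exact ⟨i, hi', hD' i hi' _ hi, hi''⟩)
    have hD2 := hDcount v₂ (fun γ => ⟨by linarith [(hb₂ γ).1], (hb₂ γ).2⟩) (fun γ => by
      obtain ⟨i, hi, hi', hi''⟩ := hc₂ γ
      exact ⟨i, hi', hD' i hi' _ hi, hi''⟩)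
    have hD3 := hDcount (fun γ => -1 - v₁ γ)
      (fun γ => ⟨by linarith [(hb₁ γ).2], by linarith [(hb₁ γ).1]⟩) (fun γ => by
      obtain ⟨i, hi, hi', hi''⟩ := hc₁ γ
      refine ⟨i, hi', ?_, ?_⟩
      · have := hD' i hi' _ hi
        rwa [show (m : ℤ) + 1 + (-1 - v₁ γ) = m - v₁ γ by ring,
          show (m : ℤ) - (-1 - v₁ γ) = m + 1 + v₁ γ by ring, mul_comm (h.choose _)]
      · simpa using hi'')
    set NE := (Finset.univ.filter (fun γ => e (u γ) = s)).card
    set N1 := (Finset.univ.filter (fun γ => d (v₁ γ) = s)).card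
    set N2 := (Finset.univ.filter (fun γ => d (v₂ γ) = s)).card
    set N3 := (Finset.univ.filter (fun γ => d (-1 - v₁ γ) = s)).card
    -- The parity of `s.1 + s.2` decides whether the even position or the odd ones can use `s`.
    by_cases hz : NE = 0
    · rw [hz]
      have := hD1.1
      have := hD2.1
      have := hD3.1
      have : 2 * (t + 1) * (0 + (N1 + N2 + t * (N1 + N3))) ≤ 2 * (t + 1) * C := by
        nlinarith
      exact Nat.le_of_mul_le_mul_left this (by omega)
    · have h1 := hEcount.2 hz
      have e1 : N1 = 0 := by
        by_contra hne
        have := hD1.2 hne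
        omega
      have e2 : N2 = 0 := by
        by_contra hne
        have := hD2.2 hne
        omega
      have e3 : N3 = 0 := by
        by_contra hne
        have := hD3.2 hne
        omega
      rw [e1, e2, e3]
      simpa using hEcount.1
  · rintro γ (_ | x)
    · have := hbu γ
      have := hm0 γ
      simp only [τ, e, val]
      omega
    · have := (hval γ x).1
      simp only [τ, d]
      omega
  · rintro γ (_ | x) γ' (_ | x') hle
    · have := hbu γ
      have := hbu γ'
      simp only [τ, e, val, Prod.le_def, Prod.ext_iff] at hle ⊢
      omega
    · have h1 := hbu γ
      have h2 := (hval γ' x').1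
      have h3 := hsep γ γ' x'
      simp only [τ, e, d, Prod.le_def] at hle
      change (m' + u γ).toNat ≤ _ ∧ (m' - u γ).toNat ≤ _ at hle
      omega
    · have h1 := hbu γ'
      have h2 := (hval γ x).1
      have h3 := hsep γ' γ x
      simp only [τ, e, d, Prod.le_def] at hle
      change _ ≤ (m' + u γ').toNat ∧ _ ≤ (m' - u γ').toNat at hle
      omega
    · have h1 := (hval γ x).1
      have h2 := (hval γ' x').1
      simp only [τ, d, Prod.le_def, Prod.ext_iff] at hle ⊢
      omega

/-! ### The upper bound: convexity and the LYM inequality -/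

theorem Nat.choose_mul_choose_le_sq {n x : ℕ} (hx : x + 2 ≤ n) :
    n.choose x * n.choose (x + 2) ≤ n.choose (x + 1) ^ 2 := by
  have h1 := Nat.choose_succ_right_eq n x
  have h2 := Nat.choose_succ_right_eq n (x + 1)
  obtain ⟨y, rfl⟩ := Nat.exists_eq_add_of_le hx
  rw [show x + 2 + y - x = y + 2 by omega] at h1
  rw [show x + 2 + y - (x + 1) = y + 1 by omega] at h2
  set a := (x + 2 + y).choose x
  set b := (x + 2 + y).choose (x + 1)
  set c := (x + 2 + y).choose (x + 1 + 1)
  have h3 : (a * c) * ((y + 2) * (x + 2)) = b ^ 2 * ((x + 1) * (y + 1)) := by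
    calc (a * c) * ((y + 2) * (x + 2)) = (a * (y + 2)) * (c * (x + 1 + 1)) := by ring
      _ = _ := by rw [← h1, h2]; ring
  have h4 : b ^ 2 * ((x + 1) * (y + 1)) ≤ b ^ 2 * ((y + 2) * (x + 2)) :=
    Nat.mul_le_mul_left _ (by nlinarith)
  exact Nat.le_of_mul_le_mul_right (h3.le.trans h4) (by positivity)

/-- The forward difference of `x ↦ 1 / binom(n, x)` is increasing. -/
theorem inv_choose_sub_le {n x y : ℕ} (hxy : x ≤ y) (hy : y + 1 ≤ n) :
    ((n.choose (x + 1) : ℝ))⁻¹ - (n.choose x : ℝ)⁻¹ ≤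
      ((n.choose (y + 1) : ℝ))⁻¹ - (n.choose y : ℝ)⁻¹ := by
  induction y, hxy using Nat.le_induction with
  | base => exact le_rfl
  | succ y hxy ih =>
    refine (ih (by omega)).trans ?_
    have ha : (0 : ℝ) < n.choose y := by exact_mod_cast Nat.choose_pos (by omega)
    have hb : (0 : ℝ) < n.choose (y + 1) := by exact_mod_cast Nat.choose_pos (by omega)
    have hc : (0 : ℝ) < n.choose (y + 1 + 1) := by exact_mod_cast Nat.choose_pos (by omega)
    have h : (n.choose y : ℝ) * n.choose (y + 1 + 1) ≤ (n.choose (y + 1) : ℝ) ^ 2 := by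
      exact_mod_cast Nat.choose_mul_choose_le_sq (n := n) (x := y) (by omega)
    generalize (n.choose y : ℝ) = a at *
    generalize (n.choose (y + 1) : ℝ) = b at *
    generalize (n.choose (y + 1 + 1) : ℝ) = c at *
    -- By log-concavity `b` is at least the geometric, hence the harmonic, mean of `a` and `c`.
    have h2 : 2 * (a * c) ≤ (a + c) * b := by
      refine abs_le_of_sq_le_sq' ?_ (by positivity) |>.2
      have h3 : a * c * (a * c) ≤ a * c * b ^ 2 := by gcongr
      nlinarith [mul_nonneg (sq_nonneg (a - c)) (sq_nonneg b)]
    have h4 : 2 * b⁻¹ ≤ a⁻¹ + c⁻¹ := by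
      rw [inv_add_inv ha.ne' hc.ne', ← div_eq_mul_inv, div_le_div_iff₀ hb (by positivity)]
      exact h2
    linarith

/-- The differences increase, so adding them up from `c` in either direction stays above the chord
through `c` and `c + 1`. -/
theorem inv_choose_supporting_line {n c x : ℕ} (hc : c + 1 ≤ n) (hx : x ≤ n) :
    (n.choose c : ℝ)⁻¹ + ((x : ℝ) - c) * ((n.choose (c + 1) : ℝ)⁻¹ - (n.choose c : ℝ)⁻¹) ≤
      (n.choose x : ℝ)⁻¹ := by
  rcases le_total c x with h | h
  · induction x, h using Nat.le_induction with
    | base => simp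
    | succ x hcx ih =>
      have h1 := ih (by omega)
      have h2 := inv_choose_sub_le hcx hx
      push_cast
      linarith
  · obtain ⟨d, rfl⟩ := Nat.exists_eq_add_of_le h
    clear h
    have key : ∀ e, e ≤ d → ((n.choose (x + d) : ℝ))⁻¹ + ((x + (d - e) : ℝ) - (x + d)) *
        ((n.choose (x + d + 1) : ℝ)⁻¹ - (n.choose (x + d) : ℝ)⁻¹) ≤
          (n.choose (x + (d - e)) : ℝ)⁻¹ := by
      intro e
      induction e with
      | zero => intro _; simp
      | succ e ih =>
        intro he
        have h1 := ih (by omega)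
        have h2 := inv_choose_sub_le (n := n) (x := x + (d - (e + 1))) (y := x + d) (by omega) hc
        rw [show x + (d - (e + 1)) + 1 = x + (d - e) by omega] at h2
        push_cast
        linarith
    have := key d le_rfl
    simp only [Nat.sub_self, sub_self, add_zero] at this
    push_cast
    exact this

theorem SP_le_MMS {n k : ℕ} (hk : 2 ≤ k) (hkn : k ≤ n) : (SP n k : ℝ) ≤ MMS n k := by
  classical
  obtain ⟨S, ⟨hS1, hS2⟩, hScard⟩ := (SP_isGreatest n k).1
  set c := n / k with hc
  set r := n % k with hr
  have hdiv : k * c + r = n := Nat.div_add_mod n k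
  have hcpos : 0 < c := Nat.div_pos hkn (by omega)
  have hcn : c + 1 ≤ n := by nlinarith
  set 𝒜 : Finset (Finset (Fin n)) := S.biUnion (fun P => P.parts) with h𝒜
  have hanti : IsAntichain (· ⊆ ·) (𝒜 : Set (Finset (Fin n))) := by
    intro A hA B hB hAB hsub
    simp only [h𝒜, Finset.coe_biUnion, Set.mem_iUnion, Finset.mem_coe, exists_prop] at hA hB
    obtain ⟨P, hP, hA⟩ := hA
    obtain ⟨Q, hQ, hB⟩ := hB
    by_cases hPQ : P = Q
    · subst hPQ
      have hd : Disjoint A B := P.disjoint hA hB hAB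
      exact (P.nonempty_of_mem_parts hA).ne_empty (Finset.disjoint_self_iff_empty _ |>.1
        (hd.mono_right hsub))
    · exact hS2 P hP Q hQ hPQ A hA B hB hsub
  have hLYM := Finset.lubell_yamamoto_meshalkin_inequality_sum_inv_choose (𝕜 := ℝ) hanti
  rw [Fintype.card_fin, h𝒜, Finset.sum_biUnion] at hLYM
  swap
  · intro P hP Q hQ hPQ
    rw [Function.onFun, Finset.disjoint_left]
    intro A hA hA'
    exact hS2 P hP Q hQ hPQ A hA A hA' (Finset.Subset.refl A)
  have hc0 : (0 : ℝ) < n.choose c := by exact_mod_cast Nat.choose_pos (by omega)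
  have hc1 : (0 : ℝ) < n.choose (c + 1) := by exact_mod_cast Nat.choose_pos (by omega)
  have hnc : (0 : ℝ) < (n : ℝ) - c := by
    rw [sub_pos]; exact_mod_cast (by omega : c < n)
  have hsucc : (n.choose (c + 1) : ℝ)⁻¹ = (c + 1) / (n - c) * (n.choose c : ℝ)⁻¹ := by
    have h := Nat.choose_succ_right_eq n c
    have h' : (n.choose (c + 1) : ℝ) * (c + 1) = n.choose c * (n - c) := by
      rw [← Nat.cast_sub (by omega)]; exact_mod_cast h
    field_simp
    linarith
  have hrk : (r : ℝ) < k := by exact_mod_cast Nat.mod_lt n (by omega)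
  set D : ℝ := (k : ℝ) - r + r * (c + 1) / (n - c) with hD
  have hDpos : 0 < D := by
    have : (0 : ℝ) ≤ r * (c + 1) / (n - c) := by positivity
    linarith
  -- The linear lower bound depends on the part sizes only through their sum `n`, and `n - k * c =
  -- r`.
  have hpart : ∀ P ∈ S, D * (n.choose c : ℝ)⁻¹ ≤ ∑ A ∈ P.parts, (n.choose A.card : ℝ)⁻¹ := by
    intro P hP
    have h1 : ∑ A ∈ P.parts, ((n.choose c : ℝ)⁻¹ + ((A.card : ℝ) - c) *
        ((n.choose (c + 1) : ℝ)⁻¹ - (n.choose c : ℝ)⁻¹)) ≤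
        ∑ A ∈ P.parts, (n.choose A.card : ℝ)⁻¹ :=
      Finset.sum_le_sum fun A _ => inv_choose_supporting_line hcn
        (by simpa using Finset.card_le_univ A)
    refine le_trans (le_of_eq ?_) h1
    have h2 : ∑ A ∈ P.parts, (A.card : ℝ) = n := by
      rw [← Nat.cast_sum, P.sum_card_parts]
      simp
    rw [Finset.sum_add_distrib, ← Finset.sum_mul, Finset.sum_sub_distrib, h2, Finset.sum_const,
      Finset.sum_const, hS1 P hP, hsucc, hD]
    have h3 : (n : ℝ) = k * c + r := by exact_mod_cast hdiv.symm
    simp only [nsmul_eq_mul]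
    have h4 : (n : ℝ) - k * c = r := by linarith
    rw [h4]
    ring
  have hfin : (SP n k : ℝ) * (D * (n.choose c : ℝ)⁻¹) ≤ 1 := by
    refine le_trans ?_ hLYM
    rw [← hScard, ← nsmul_eq_mul, ← Finset.sum_const]
    exact Finset.sum_le_sum hpart
  have hM : MMS n k = (n.choose c : ℝ) / D := rfl
  rw [hM, le_div_iff₀ hDpos]
  rwa [← mul_assoc, ← div_eq_mul_inv, div_le_one hc0] at hfin

/-! ### Estimates for the numbers of sets of each type -/

theorem Nat.succ_le_choose_add (j : ℕ) {p : ℕ} (hp : 1 ≤ p) : j + 1 ≤ (j + p).choose p := by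
  obtain ⟨p, rfl⟩ : ∃ s, p = s + 1 := ⟨p - 1, by omega⟩
  induction j with
  | zero => simp
  | succ j ih =>
    rw [show j + 1 + (p + 1) = (j + (p + 1)) + 1 by ring, Nat.choose_succ_succ, Nat.succ_eq_add_one]
    have : 0 < (j + (p + 1)).choose p := Nat.choose_pos (by omega)
    omega

/-- The number of sets with `p + u` elements in one and `p' - u` elements in the other of two given
disjoint `h`-sets. -/
def layerCount (h p p' u : ℕ) : ℕ := if u ≤ p' then h.choose (p + u) * h.choose (p' - u) else 0

theorem layerCount_succ_mul {h p p' u : ℕ} (hu : u + 1 ≤ p') (hp' : p' ≤ h) :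
    layerCount h p p' (u + 1) * ((p + u + 1) * (h - p' + u + 1)) =
      layerCount h p p' u * ((h - p - u) * (p' - u)) := by
  unfold layerCount
  rw [if_pos hu, if_pos (by omega)]
  obtain ⟨v, rfl⟩ := Nat.exists_eq_add_of_le hu
  have h1 := Nat.choose_succ_right_eq h (p + u)
  have h2 := Nat.choose_succ_right_eq h v
  rw [show u + 1 + v - (u + 1) = v by omega, show u + 1 + v - u = v + 1 by omega,
    show h - (u + 1 + v) + u + 1 = h - v by omega, show p + (u + 1) = p + u + 1 by ring,
    show h - p - u = h - (p + u) by omega]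
  calc _ = (h.choose (p + u + 1) * (p + u + 1)) * (h.choose v * (h - v)) := by ring
    _ = _ := by rw [h1, ← h2]; ring

/-- Consecutive quotients are at most one because `p' ≤ p`; out of range the count is zero. -/
theorem layerCount_antitone {h p p' : ℕ} (hp : p' ≤ p) (hp' : p' ≤ h) :
    Antitone (layerCount h p p') := by
  refine antitone_nat_of_succ_le fun u => ?_
  by_cases hu : u + 1 ≤ p'
  · by_cases hh : p + u ≤ h
    · have h1 := layerCount_succ_mul (p := p) hu hp'
      have h2 : (h - p - u) * (p' - u) ≤ (p + u + 1) * (h - p' + u + 1) := by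
        rw [mul_comm]
        exact Nat.mul_le_mul (by omega) (by omega)
      exact Nat.le_of_mul_le_mul_right (h1.le.trans (Nat.mul_le_mul_left _ h2)) (by positivity)
    · unfold layerCount
      rw [Nat.choose_eq_zero_of_lt (show h < p + (u + 1) by omega)]
      simp
  · simp [layerCount, hu]

theorem sum_layerCount_le (h p p' : ℕ) :
    ∑ u ∈ Finset.range (p' + 1), layerCount h p p' u ≤ (2 * h).choose (p + p') := by
  rw [two_mul, Nat.add_choose_eq, Finset.Nat.sum_antidiagonal_eq_sum_range_succ_mk,
    show (p + p').succ = p + (p' + 1) by omega, Finset.sum_range_add _ p (p' + 1)]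
  refine le_trans (Finset.sum_le_sum fun u hu => ?_) (Nat.le_add_left _ _)
  have := Finset.mem_range.1 hu
  rw [layerCount, if_pos (by omega), show p + p' - (p + u) = p' - u by omega]

/-- In Vandermonde's identity, exchanging the halves sends the terms with fewer than `p` elements in
the first half to terms of the sum; `p ≤ p' + 1` keeps them in range. -/
theorem choose_le_sum_layerCount {h p p' : ℕ} (hp : p ≤ p' + 1) :
    (2 * h).choose (p + p') ≤ 2 * ∑ u ∈ Finset.range (p' + 1), layerCount h p p' u := by
  rw [two_mul, Nat.add_choose_eq, Finset.Nat.sum_antidiagonal_eq_sum_range_succ_mk,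
    show (p + p').succ = p + (p' + 1) by omega, Finset.sum_range_add, two_mul]
  refine Nat.add_le_add ?_ ?_
  · refine (Finset.sum_le_sum_of_subset (Finset.range_mono hp)).trans ?_
    rw [← Finset.sum_range_reflect]
    refine Finset.sum_le_sum fun u hu => ?_
    have := Finset.mem_range.1 hu
    dsimp only
    rw [layerCount, if_pos (by omega), mul_comm, show p' + 1 - 1 - u = p' - u by omega,
      show p + p' - (p' - u) = p + u by omega]
  · refine Finset.sum_le_sum fun u hu => ?_
    have := Finset.mem_range.1 hu
    rw [layerCount, if_pos (by omega), show p + p' - (p + u) = p' - u by omega]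

/-- Here `G / F = (B / X) (A / Y)` with both factors at least `1 - y / p`, and `(1 - y / p)² ≥ 1 - 2
y / p`. -/
theorem mul_sub_two_mul_le_of_ratio {F G p X Y A B y : ℝ} (hF : 0 ≤ F) (hp : 0 < p) (hX : 0 < X)
    (hY : 0 < Y) (hB : 0 ≤ B) (hy : y ≤ p) (h : G * (X * Y) = F * (A * B))
    (h1 : X * (p - y) ≤ B * p) (h2 : Y * (p - y) ≤ A * p) : F * (p - 2 * y) ≤ G * p := by
  have h3 : (X * (p - y)) * (Y * (p - y)) ≤ (B * p) * (A * p) :=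
    mul_le_mul h1 h2 (mul_nonneg hY.le (by linarith)) (mul_nonneg hB hp.le)
  have h4 := mul_le_mul_of_nonneg_left h3 hF
  have h5 : (F * (p - y) ^ 2) * (X * Y) ≤ (G * p ^ 2) * (X * Y) := by
    calc _ = F * ((X * (p - y)) * (Y * (p - y))) := by ring
      _ ≤ _ := h4
      _ = (F * (A * B)) * p ^ 2 := by ring
      _ = _ := by rw [← h]; ring
  have h6 := le_of_mul_le_mul_right h5 (by positivity)
  have h7 : (F * (p - 2 * y)) * p ≤ (G * p) * p := by
    have : F * (p * (p - 2 * y)) ≤ F * (p - y) ^ 2 :=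
      mul_le_mul_of_nonneg_left (by linarith [sq_nonneg y, (by ring :
        (p - y) ^ 2 = p * (p - 2 * y) + y ^ 2)]) hF
    linarith
  exact le_of_mul_le_mul_right h7 hp

/-- The decay per step is only a factor `1 - O((u + 1) / p)`, so on the order of `√p` counts stay
comparable to the largest. -/
theorem layerCount_mul_sub_le {h p p' u : ℕ} (hp : p ≤ p' + 1) (hp' : p' ≤ p) (hh : 2 * p ≤ h)
    (hu : 2 * u + 2 ≤ p) (hu' : u + 1 ≤ p') :
    (layerCount h p p' u : ℝ) * (p - 2 * (2 * u + 2)) ≤ layerCount h p p' (u + 1) * p := by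
  have h1 := layerCount_succ_mul (h := h) (p := p) hu' (by omega)
  have h1' : (layerCount h p p' (u + 1) : ℝ) * ((p + u + 1) * (h - p' + u + 1)) =
      layerCount h p p' u * ((h - p - u) * (p' - u)) := by
    rw [← Nat.cast_sub (show p' ≤ h by omega), ← Nat.cast_sub (show p ≤ h by omega),
      ← Nat.cast_sub (show u ≤ h - p by omega), ← Nat.cast_sub (show u ≤ p' by omega)]
    exact_mod_cast h1
  have hpp : (p : ℝ) ≤ p' + 1 := by exact_mod_cast hp
  have hpp' : (p' : ℝ) ≤ p := by exact_mod_cast hp'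
  have hhh : 2 * (p : ℝ) ≤ h := by exact_mod_cast hh
  have hup : (2 * (u : ℝ) + 2) ≤ p := by exact_mod_cast hu
  have hup' : (u : ℝ) + 1 ≤ p' := by exact_mod_cast hu'
  have hu0 : (0 : ℝ) ≤ u := Nat.cast_nonneg u
  have hp0 : (0 : ℝ) < p := by linarith
  refine mul_sub_two_mul_le_of_ratio (Nat.cast_nonneg _) hp0 (by positivity) (by linarith)
    (by linarith) hup h1' ?_ ?_
  · have : ((p' : ℝ) - u) * p ≥ (p - 1 - u) * p := mul_le_mul_of_nonneg_right (by linarith) hp0.le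
    linarith [mul_nonneg hu0 hp0.le, mul_nonneg hu0 hu0, (by ring : ((p : ℝ) - 1 - u) * p -
      (p + u + 1) * (p - (2 * u + 2)) = 2 * (u * u) + 4 * u + 2)]
  · have h3 : (h : ℝ) - p' + u + 1 ≤ h - p + u + 2 := by linarith
    have h4 : ((h : ℝ) - p' + u + 1) * (p - (2 * u + 2)) ≤ (h - p + u + 2) * (p - (2 * u + 2)) :=
      mul_le_mul_of_nonneg_right h3 (by linarith)
    have h5 : 0 ≤ ((h : ℝ) - 2 * p) * (2 * u + 2) := mul_nonneg (by linarith) (by linarith)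
    linarith [mul_nonneg hu0 hu0, (by ring : ((h : ℝ) - p - u) * p -
      (h - p + u + 2) * (p - (2 * u + 2)) =
      (h - 2 * p) * (2 * u + 2) + 2 * (u * u) + 6 * u + 4)]

/-- The largest layer is negligible. -/
theorem layerCount_zero_le {h p p' M : ℕ} (hp : p ≤ p' + 1) (hp' : p' ≤ p) (hh : 2 * p ≤ h)
    (hM : 8 * (M + 1) ^ 2 ≤ p) :
    (M + 1) * layerCount h p p' 0 ≤ 2 * (2 * h).choose (p + p') := by
  have hMp : 2 * M + 2 ≤ p' := by nlinarith
  have hp0 : (0 : ℝ) < p := by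
    have : 0 < p := by omega
    exact_mod_cast this
  have hMq : (8 : ℝ) * (M + 1) ^ 2 ≤ p := by exact_mod_cast hM
  -- Each of the at most `M` steps loses at most the fraction `4 (M + 1) / p` of the largest count;
  -- `hM` keeps the total loss below one half.
  have key : ∀ u : ℕ, u ≤ M → (layerCount h p p' 0 : ℝ) * (p - u * (4 * (M + 1))) ≤
      layerCount h p p' u * p := by
    intro u
    induction u with
    | zero => intro _; simp
    | succ u ih =>
      intro hu
      have ih := ih (by omega)
      have h7 := layerCount_mul_sub_le (h := h) (u := u) hp hp' hh (by omega) (by omega)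
      have hle : (layerCount h p p' u : ℝ) ≤ layerCount h p p' 0 :=
        Nat.cast_le.2 (layerCount_antitone hp' (show p' ≤ h by omega) (Nat.zero_le u))
      have hu0 : (u : ℝ) + 1 ≤ M := by exact_mod_cast hu
      have h8 : (layerCount h p p' u : ℝ) * (2 * (2 * u + 2)) ≤
          layerCount h p p' 0 * (4 * (M + 1)) :=
        mul_le_mul hle (by linarith) (by positivity) (Nat.cast_nonneg _)
      push_cast
      linarith
  have h2 : ∀ u ∈ Finset.range (M + 1), (layerCount h p p' 0 : ℝ) / 2 ≤ layerCount h p p' u := by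
    intro u hu
    have hu' : u ≤ M := by have := Finset.mem_range.1 hu; omega
    have h3 := key u hu'
    have h4 : (u : ℝ) * (4 * (M + 1)) ≤ p / 2 := by
      have : (u : ℝ) ≤ M := by exact_mod_cast hu'
      nlinarith [Nat.cast_nonneg (α := ℝ) M]
    have h5 : (layerCount h p p' 0 : ℝ) * (p / 2) ≤
        layerCount h p p' 0 * (p - u * (4 * (M + 1))) :=
      mul_le_mul_of_nonneg_left (by linarith) (Nat.cast_nonneg _)
    have h6 : (layerCount h p p' 0 : ℝ) / 2 * p ≤ layerCount h p p' u * p := by linarith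
    exact le_of_mul_le_mul_right h6 hp0
  have h3 := Finset.sum_le_sum h2
  rw [Finset.sum_const, Finset.card_range, nsmul_eq_mul] at h3
  have h4 : ∑ u ∈ Finset.range (M + 1), layerCount h p p' u ≤ (2 * h).choose (p + p') :=
    (Finset.sum_le_sum_of_subset (Finset.range_mono (by omega))).trans (sum_layerCount_le h p p')
  have h5 : (∑ u ∈ Finset.range (M + 1), (layerCount h p p' u : ℝ)) ≤
      ((2 * h).choose (p + p') : ℝ) := by exact_mod_cast h4
  have h6 : ((M + 1 : ℕ) : ℝ) * layerCount h p p' 0 ≤ 2 * (2 * h).choose (p + p') := by linarith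
  exact_mod_cast h6

/-! ### The construction with explicit error terms -/

theorem sum_range_le_of_antitone {f : ℕ → ℕ} (hf : Antitone f) (a Q N : ℕ) :
    ∑ u ∈ Finset.range (a + Q * N), f u ≤ a * f 0 + Q * ∑ i ∈ Finset.range N, f (a + Q * i) := by
  induction N with
  | zero =>
    simp only [mul_zero, add_zero, Finset.range_zero, Finset.sum_empty]
    calc _ ≤ ∑ _u ∈ Finset.range a, f 0 := Finset.sum_le_sum fun u _ => hf (Nat.zero_le u)
      _ = _ := by simp
  | succ N ih =>
    rw [show a + Q * (N + 1) = (a + Q * N) + Q by ring, Finset.sum_range_add,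
      Finset.sum_range_succ _ N, mul_add, ← add_assoc]
    refine Nat.add_le_add ih ?_
    calc _ ≤ ∑ _u ∈ Finset.range Q, f (a + Q * N) :=
          Finset.sum_le_sum fun u _ => hf (Nat.le_add_right _ _)
      _ = _ := by simp

/-- A quantitative form of the construction. -/
theorem le_SP_of_layerCount {n h k m m' p' t b L D Q : ℕ} (ht : 1 ≤ t) (hk : k = 2 * t + 1)
    (hn : n = 2 * h) (hm' : m' = m ∨ m' = m + 1) (hh : h = m' + t * (2 * m + 1))
    (hp' : p' = m ∨ p' = m + 1) (hQ : Q = (2 * b + 1) * L + 2 * b + 2) (hD0 : 0 < D)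
    (hph : p' ≤ h)
    (hE : ∀ u, u ≤ m' → u + 1 ≤ p' →
      L * (layerCount h (m + 1) p' (u + 1) / D) ≤ h.choose (m' + u) * h.choose (m' - u))
    (hD : ∀ v, v ≤ m → v + 1 ≤ p' →
      2 * t * (layerCount h (m + 1) p' (v + 1) / D) ≤ h.choose (m + 1 + v) * h.choose (m - v)) :
    (L : ℝ) * (2 * b + 1) * ((n.choose (m + 1 + p') : ℝ) -
      (3 * Q + 2) * layerCount h (m + 1) p' 0 - 2 * Q * D * (p' + 1)) ≤ SP n k * Q * D := by
  set f := layerCount h (m + 1) p' with hf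
  have hanti : Antitone f := layerCount_antitone (by omega) hph
  -- By monotonicity the count at the far end `(i + 1) * Q` of a block serves the whole block. The
  -- extra `+ 1` provides the shift that `hE` and `hD` allow when comparing the two layers.
  set w : ℕ → ℕ := fun i => f ((i + 1) * Q + 1) / D with hw
  have hw_anti : Antitone w := fun i j hij =>
    Nat.div_le_div_right (hanti (by gcongr))
  have hfz : ∀ u, p' < u → f u = 0 := fun u hu => by
    rw [hf, layerCount, if_neg (by omega)]
  have hQ1 : 1 ≤ Q := by omega
  have hwr : ∀ i, w i ≠ 0 → (i + 1) * Q + 1 ≤ p' := by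
    intro i hi
    by_contra hlt
    exact hi (by rw [hw]; simp [hfz _ (not_le.1 hlt)])
  have hwN : w (p' + 1) = 0 := by
    by_contra h0
    have := hwr _ h0
    nlinarith
  have h1 := le_SP_of_weights (n := n) (k := k) (b := b) (L := L) hw_anti hwN ht hk hn hm' hh hQ
    (fun i hi => by have := hwr i hi; omega)
    (fun i hi u hu => by
      have h2 := hwr i hi
      refine le_trans (Nat.mul_le_mul_left _ (Nat.div_le_div_right (hanti ?_)))
        (hE u (by omega) (by omega))
      omega)
    (fun i hi v hv => by
      have h2 := hwr i hi
      refine le_trans (Nat.mul_le_mul_left _ (Nat.div_le_div_right (hanti ?_)))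
        (hD v (by omega) (by omega))
      omega)
  have h2 : n.choose (m + 1 + p') ≤ 2 * ((Q + 1) * f 0 +
      Q * ∑ i ∈ Finset.range (p' + 1), f (Q + 1 + Q * i)) := by
    rw [hn]
    refine (choose_le_sum_layerCount (by omega)).trans (Nat.mul_le_mul_left _ ?_)
    refine le_trans ?_ (sum_range_le_of_antitone hanti (Q + 1) Q (p' + 1))
    refine Finset.sum_le_sum_of_subset (Finset.range_mono ?_)
    nlinarith
  have h3 : ∀ i, f (Q + 1 + Q * i) ≤ D * w i + D := by
    intro i
    have := Nat.lt_div_mul_add (a := f ((i + 1) * Q + 1)) hD0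
    rw [show Q + 1 + Q * i = (i + 1) * Q + 1 by ring]
    simp only [hw]
    rw [mul_comm D]
    exact this.le
  have h4 : ∑ i ∈ Finset.range (p' + 1), f (Q + 1 + Q * i) ≤
      D * ∑ i ∈ Finset.range (p' + 1), w i + (p' + 1) * D := by
    refine (Finset.sum_le_sum fun i _ => h3 i).trans ?_
    rw [Finset.sum_add_distrib, Finset.mul_sum]
    simp
  have h5 : D * w 0 ≤ f 0 := (Nat.mul_div_le _ _).trans (hanti (Nat.zero_le _))
  set W := ∑ i ∈ Finset.range (p' + 1), w i
  have h1' : ((2 * b + 1 : ℝ)) * L * (2 * W) ≤ SP n k + (2 * b + 1) * L * w 0 := by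
    exact_mod_cast h1
  have h2' : (n.choose (m + 1 + p') : ℝ) ≤ 2 * ((Q + 1) * f 0 + Q * (D * W + (p' + 1) * D)) := by
    exact_mod_cast h2.trans (Nat.mul_le_mul_left _ (Nat.add_le_add_left
      (Nat.mul_le_mul_left _ h4) _))
  have h5' : (D : ℝ) * w 0 ≤ f 0 := by exact_mod_cast h5
  have hQ0 : (0 : ℝ) ≤ Q := Nat.cast_nonneg _
  calc (L : ℝ) * (2 * b + 1) * ((n.choose (m + 1 + p') : ℝ) - (3 * Q + 2) * f 0 -
        2 * Q * D * (p' + 1))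
      ≤ (L : ℝ) * (2 * b + 1) * ((2 * W - w 0) * (Q * D)) := by
        refine mul_le_mul_of_nonneg_left ?_ (by positivity)
        have := mul_le_mul_of_nonneg_left h5' hQ0
        linarith
    _ = ((2 * b + 1 : ℝ) * L * (2 * W) - (2 * b + 1) * L * w 0) * (Q * D) := by ring
    _ ≤ SP n k * (Q * D) := mul_le_mul_of_nonneg_right (by linarith) (by positivity)
    _ = _ := by ring

theorem Nat.choose_succ_le_mul {h a r : ℕ} (hr : h - a ≤ r * (a + 1)) :
    h.choose (a + 1) ≤ r * h.choose a := by
  have h1 := Nat.choose_succ_right_eq h a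
  have h2 : h.choose (a + 1) * (a + 1) ≤ (r * h.choose a) * (a + 1) := by
    rw [h1]
    calc _ ≤ h.choose a * (r * (a + 1)) := Nat.mul_le_mul_left _ hr
      _ = _ := by ring
  exact Nat.le_of_mul_le_mul_right h2 (by omega)

/-- The construction with its error terms estimated, for `n = k c + 1` with `c = 2 m + 1` odd
(`m' = m + 1`) and for `n = k c + k - 1` with `c = 2 m` even (`m' = m`). -/
theorem mul_choose_le_SP {n h k m m' t b L D Q M : ℕ} (ht : 1 ≤ t) (hk : k = 2 * t + 1)
    (hn : n = 2 * h) (hh : h = m' + t * (2 * m + 1))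
    (hcase : (m' = m + 1 ∧ D = 4 * t ^ 2 ∧ L ≤ D) ∨ (m' = m ∧ D = 2 * t ∧ L = 1))
    (hQ : Q = (2 * b + 1) * L + 2 * b + 2) (hm : 1 ≤ m) (hM : 8 * (M + 1) ^ 2 ≤ m + 1) :
    (L : ℝ) * (2 * b + 1) * (n.choose (m + 1 + m') *
      (1 - (6 * Q + 4) / (M + 1) - 6 * Q / m)) ≤ SP n k * Q * D := by
  have hm' : m' = m ∨ m' = m + 1 := by omega
  have hmt : 2 * m + 1 ≤ t * (2 * m + 1) := Nat.le_mul_of_pos_left _ ht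
  have htm : t ≤ t * (2 * m + 1) := Nat.le_mul_of_pos_right _ (by omega)
  have ht2 : t ≤ t ^ 2 := Nat.le_self_pow (by omega) t
  have hD0 : 0 < D := by
    rcases hcase with ⟨-, h, -⟩ | ⟨-, h, -⟩ <;> omega
  have hD4 : D ≤ 4 * t ^ 2 := by
    rcases hcase with ⟨-, h, -⟩ | ⟨-, h, -⟩ <;> omega
  have hanti : Antitone (layerCount h (m + 1) m') := layerCount_antitone (by omega) (by omega)
  have hmain := le_SP_of_layerCount (b := b) (L := L) (D := D) (p' := m') ht hk hn hm' hh hm' hQ hD0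
    (by omega) (by
      intro u hu hu'
      have h1 := hanti (Nat.le_succ u)
      rcases hcase with ⟨h2, h3, h4⟩ | ⟨h2, h3, h4⟩
      · calc L * (layerCount h (m + 1) m' (u + 1) / D)
            ≤ D * (layerCount h (m + 1) m' (u + 1) / D) := Nat.mul_le_mul_right _ h4
          _ ≤ layerCount h (m + 1) m' (u + 1) := Nat.mul_div_le _ _
          _ ≤ layerCount h (m + 1) m' u := h1
          _ = _ := by rw [layerCount, if_pos hu, h2]
      · rw [h4, one_mul]
        refine Nat.div_le_of_le_mul (h1.trans ?_)
        rw [layerCount, if_pos hu, h2, h3, ← mul_assoc, show m + 1 + u = m + u + 1 by ring]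
        refine Nat.mul_le_mul_right _ (Nat.choose_succ_le_mul ?_)
        have : 2 * t * (m + u + 1) = t * (2 * m + 1) + t + 2 * (t * u) := by ring
        omega)
    (by
      intro v hv hv'
      have h1 := hanti (Nat.le_succ v)
      rcases hcase with ⟨h2, h3, h4⟩ | ⟨h2, h3, h4⟩
      -- One factor `2 * t` accounts for the odd positions; the other passes from the layer of size
      -- `2 m + 2` to that of size `2 m + 1`. The shift `v + 1` aligns the second coordinates.
      · refine le_of_mul_le_mul_left (a := 2 * t) ?_ (by omega)
        calc 2 * t * (2 * t * (layerCount h (m + 1) m' (v + 1) / D))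
            = D * (layerCount h (m + 1) m' (v + 1) / D) := by rw [h3]; ring
          _ ≤ layerCount h (m + 1) m' (v + 1) := Nat.mul_div_le _ _
          _ ≤ _ := by
            rw [layerCount, if_pos hv', h2, ← mul_assoc, Nat.add_sub_add_right]
            refine Nat.mul_le_mul_right _ (Nat.choose_succ_le_mul (a := m + 1 + v) ?_)
            have : 2 * t * (m + 1 + v + 1) = t * (2 * m + 1) + 3 * t + 2 * (t * v) := by ring
            omega
      · rw [← h3]
        refine (Nat.mul_div_le _ _).trans (h1.trans ?_)
        rw [layerCount, if_pos (by omega), h2])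
  have hzero := layerCount_zero_le (h := h) (p := m + 1) (p' := m') (M := M) (by omega) (by omega)
    (by omega) hM
  rw [← hn] at hzero
  -- Growth quadratic in `m` makes the rounding loss `2 Q D (m' + 1)` a relative error of order `Q /
  -- m`.
  have hT : D * m ^ 2 ≤ n.choose (m + 1 + m') := by
    have h1 : layerCount h (m + 1) m' 0 ≤ n.choose (m + 1 + m') := by
      rw [hn]
      refine le_trans ?_ (sum_layerCount_le h (m + 1) m')
      exact Finset.single_le_sum (f := layerCount h (m + 1) m') (fun _ _ => Nat.zero_le _)
        (Finset.mem_range.2 (Nat.succ_pos _))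
    refine le_trans ?_ h1
    rw [layerCount, if_pos (Nat.zero_le _), Nat.add_zero, Nat.sub_zero]
    have h2 := Nat.succ_le_choose_add (h - (m + 1)) (p := m + 1) (by omega)
    have h3 := Nat.succ_le_choose_add (h - m') (p := m') (by omega)
    rw [Nat.sub_add_cancel (by omega)] at h2 h3
    calc D * m ^ 2 ≤ 4 * t ^ 2 * m ^ 2 := Nat.mul_le_mul_right _ hD4
      _ = (t * (2 * m)) * (t * (2 * m)) := by ring
      _ ≤ (t * (2 * m + 1)) * (t * (2 * m + 1)) := by gcongr <;> omega
      _ ≤ _ := Nat.mul_le_mul (le_trans (by omega) h2) (le_trans (by omega) h3)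
  refine le_trans (mul_le_mul_of_nonneg_left ?_ (by positivity)) hmain
  generalize n.choose (m + 1 + m') = T at hzero hT ⊢
  have hm0 : (0 : ℝ) < m := by exact_mod_cast hm
  have hz' : ((M : ℝ) + 1) * layerCount h (m + 1) m' 0 ≤ 2 * (T : ℝ) := by exact_mod_cast hzero
  have hT' : (D : ℝ) * m ^ 2 ≤ (T : ℝ) := by exact_mod_cast hT
  have e1 : (3 * (Q : ℝ) + 2) * layerCount h (m + 1) m' 0 ≤ T * ((6 * Q + 4) / (M + 1)) := by
    rw [mul_div_assoc', le_div_iff₀ (by positivity)]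
    have := mul_le_mul_of_nonneg_left hz' (show (0 : ℝ) ≤ 3 * Q + 2 by positivity)
    linarith
  have e2 : 2 * (Q : ℝ) * D * (m' + 1) ≤ T * (6 * Q / m) := by
    rw [mul_div_assoc', le_div_iff₀ hm0]
    have h1 : (m' : ℝ) + 1 ≤ 3 * m := by
      have : m' + 1 ≤ 3 * m := by omega
      exact_mod_cast this
    calc 2 * (Q : ℝ) * D * (m' + 1) * m ≤ 2 * (Q : ℝ) * D * (3 * m) * m := by gcongr
      _ = (D * m ^ 2) * (6 * Q) := by ring
      _ ≤ T * (6 * Q) := by gcongr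
  linarith

/-- The proportion of the layers covered by the intervals is close to `L / (L + 1)`. -/
theorem one_sub_mul_le_SP {n k L D Q b : ℕ} {T η : ℝ} (hT : 0 ≤ T) (hL : 1 ≤ L) (hD : 1 ≤ D)
    (hη0 : 0 ≤ η) (hb : 1 ≤ η * (2 * b + 1))
    (hQ : Q = (2 * b + 1) * L + 2 * b + 2) {δ : ℝ} (hδ : δ ≤ 1)
    (h : (L : ℝ) * (2 * b + 1) * (T * (1 - δ)) ≤ SP n k * Q * D) :
    (1 - η) * (1 - δ) * (L / ((L + 1) * D) * T) ≤ SP n k := by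
  have hL0 : (0 : ℝ) < L := by exact_mod_cast hL
  have hD0 : (0 : ℝ) < D := by exact_mod_cast hD
  have hQr : (Q : ℝ) = (2 * b + 1) * (L + 1) + 1 := by rw [hQ]; push_cast; ring
  have hQ0 : (0 : ℝ) < Q := by rw [hQr]; positivity
  have h1 : (1 - η) * Q ≤ (2 * b + 1) * (L + 1) := by
    rw [hQr]
    have := mul_le_mul_of_nonneg_right hb (show (0 : ℝ) ≤ L + 1 by positivity)
    nlinarith
  have hs : 0 ≤ T * (1 - δ) := mul_nonneg hT (by linarith)
  have h2 : (1 - η) * (1 - δ) * (L / ((L + 1) * D) * T) * (Q * D) ≤ SP n k * (Q * D) := by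
    calc (1 - η) * (1 - δ) * (L / ((L + 1) * D) * T) * (Q * D)
        = ((1 - η) * Q) * (L * (T * (1 - δ)) / (L + 1)) := by field_simp
      _ ≤ ((2 * b + 1) * (L + 1)) * (L * (T * (1 - δ)) / (L + 1)) :=
          mul_le_mul_of_nonneg_right h1 (by positivity)
      _ = L * (2 * b + 1) * (T * (1 - δ)) := by field_simp
      _ ≤ _ := h
      _ = _ := by ring
  exact le_of_mul_le_mul_right h2 (by positivity)

/-! ### Uniform lower bounds and the asymptotics -/

/-- A uniform lower bound in terms of the size of the upper of the two layers that are used. -/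
theorem eventually_le_SP {ε : ℝ} (hε : 0 < ε) (K : ℕ) :
    ∃ m₀ : ℕ, ∀ m ≥ m₀, ∀ n k m' t L D : ℕ, 1 ≤ t → k = 2 * t + 1 →
      n = 2 * (m' + t * (2 * m + 1)) → 1 ≤ L → L ≤ K →
      (m' = m + 1 ∧ D = 4 * t ^ 2 ∧ L ≤ D) ∨ (m' = m ∧ D = 2 * t ∧ L = 1) →
      (1 - ε) * (L / ((L + 1) * D) * n.choose (m + 1 + m')) ≤ (SP n k : ℝ) := by
  wlog hε1 : ε ≤ 1 generalizing ε with H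
  · obtain ⟨m₀, hm₀⟩ := H one_pos le_rfl
    refine ⟨m₀, fun m hm n k m' t L D ht hk hn hL hLK hc => ?_⟩
    refine le_trans ?_ (hm₀ m hm n k m' t L D ht hk hn hL hLK hc)
    exact mul_le_mul_of_nonneg_right (by linarith [not_le.1 hε1]) (by positivity)
  -- `ε` is shared equally by the gaps between intervals (`b`), the largest count (`M`) and the
  -- rounding of weights (`m₁`). `R` bounds `Q` for all `L ≤ K`, so the threshold depends on `ε` and
  -- `K` only.
  obtain ⟨b, hb⟩ := exists_nat_ge (3 / ε)
  set R : ℕ := (2 * b + 1) * K + 2 * b + 2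
  obtain ⟨M, hM⟩ := exists_nat_ge ((6 * R + 4) * (3 / ε))
  obtain ⟨m₁, hm₁⟩ := exists_nat_ge (6 * R * (3 / ε))
  refine ⟨8 * (M + 1) ^ 2 + m₁ + 1, fun m hm n k m' t L D ht hk hn hL hLK hc => ?_⟩
  set Q : ℕ := (2 * b + 1) * L + 2 * b + 2 with hQ
  have hQR : (Q : ℝ) ≤ R := by
    have : Q ≤ R := by simp only [Q, R]; gcongr
    exact_mod_cast this
  have hm1 : 1 ≤ m := by omega
  have hmm : (m₁ : ℝ) ≤ m := by
    have : m₁ ≤ m := by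
      have := Nat.zero_le (8 * (M + 1) ^ 2)
      omega
    exact_mod_cast this
  have hm0 : (0 : ℝ) < m := by exact_mod_cast hm1
  have hε3 : (ε / 3) * (3 / ε) = 1 := by field_simp
  have e1 : (6 * (Q : ℝ) + 4) / (M + 1) ≤ ε / 3 := by
    rw [div_le_iff₀ (by positivity)]
    calc (6 * (Q : ℝ) + 4) ≤ (6 * R + 4) := by linarith
      _ = ε / 3 * ((6 * R + 4) * (3 / ε)) := by
        rw [mul_left_comm, hε3, mul_one]
      _ ≤ ε / 3 * (M + 1) := by gcongr; linarith
  have e2 : 6 * (Q : ℝ) / m ≤ ε / 3 := by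
    rw [div_le_iff₀ hm0]
    calc 6 * (Q : ℝ) ≤ 6 * R := by linarith
      _ = ε / 3 * (6 * R * (3 / ε)) := by
        rw [mul_left_comm, hε3, mul_one]
      _ ≤ ε / 3 * m := by gcongr; linarith
  have hD : 1 ≤ D := by
    have : 1 ≤ t ^ 2 := Nat.one_le_pow _ _ ht
    rcases hc with ⟨-, h, -⟩ | ⟨-, h, -⟩ <;> omega
  have h1 := mul_choose_le_SP (b := b) (M := M) ht hk hn rfl hc hQ hm1 (by omega)
  rw [sub_sub] at h1
  have hδ : (6 * (Q : ℝ) + 4) / (M + 1) + 6 * Q / m ≤ 2 * ε / 3 := by linarith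
  have hb' : 1 ≤ ε / 3 * (2 * b + 1) := by
    rw [← hε3]
    have : (0 : ℝ) ≤ b := Nat.cast_nonneg _
    gcongr
    linarith
  have h2 := one_sub_mul_le_SP (T := (n.choose (m + 1 + m') : ℝ)) (Nat.cast_nonneg _) hL hD
    (by positivity) hb' hQ (by linarith) h1
  refine le_trans (mul_le_mul_of_nonneg_right ?_ (by positivity)) h2
  have hδ0 : 0 ≤ (6 * (Q : ℝ) + 4) / (M + 1) + 6 * Q / m := by positivity
  nlinarith [mul_nonneg (show (0 : ℝ) ≤ ε / 3 by positivity) hδ0]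

/-- Here `c = 2 m + 1` and `r = 1`. With `T = binom(n, c + 1)`, `MMS` is close to `T / (4 t² + 1)`,
and the construction gives nearly `L T / ((L + 1) 4 t²)`, which agrees when `L = 4 t²`. -/
theorem eventually_MMS_le_SP_of_one {ε : ℝ} (hε : 0 < ε) :
    ∃ m₀ : ℕ, ∀ m ≥ m₀, ∀ n k t : ℕ, 1 ≤ t → k = 2 * t + 1 →
      n = 2 * ((m + 1) + t * (2 * m + 1)) → (1 - ε) * MMS n k ≤ SP n k := by
  wlog hε1 : ε ≤ 1 generalizing ε with H
  · obtain ⟨m₀, hm₀⟩ := H one_pos le_rfl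
    refine ⟨m₀, fun m hm n k t ht hk hn => ?_⟩
    have h1 := hm₀ m hm n k t ht hk hn
    have hkn : k ≤ n := by nlinarith
    have h2 : 0 ≤ MMS n k := le_trans (Nat.cast_nonneg _) (SP_le_MMS (by omega) hkn)
    nlinarith [not_le.1 hε1]
  obtain ⟨K, hK⟩ := exists_nat_ge (3 / ε)
  obtain ⟨m₀, hm₀⟩ := eventually_le_SP (show 0 < ε / 3 by positivity) K
  have hK0 : (0 : ℝ) < K := lt_of_lt_of_le (by positivity) hK
  refine ⟨m₀ + K, fun m hm n k t ht hk hn => ?_⟩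
  have hK1 : 1 ≤ K := by exact_mod_cast hK0
  have ht2 : 1 ≤ t ^ 2 := Nat.one_le_pow _ _ ht
  -- `t` is unbounded while the threshold needs `L ≤ K`; capping the ideal ratio at `K ≥ 3 / ε`
  -- costs at most a factor `K / (K + 1)`.
  have h1 := hm₀ m (by omega) n k (m + 1) t (min (4 * t ^ 2) K) (4 * t ^ 2) ht hk hn
    (le_min (by omega) hK1) (min_le_right _ _) (Or.inl ⟨rfl, rfl, min_le_left _ _⟩)
  set T : ℝ := (n.choose (m + 1 + (m + 1)) : ℝ) with hT
  have hT0 : 0 ≤ T := Nat.cast_nonneg _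
  have hn' : n = (2 * t + 1) * (2 * m + 1) + 1 := by rw [hn]; ring
  have hdiv : n / k = 2 * m + 1 := by
    rw [hk, hn', Nat.mul_add_div (by omega), Nat.div_eq_of_lt (by omega), Nat.add_zero]
  have hmod : n % k = 1 := by
    rw [hk, hn', Nat.mul_add_mod, Nat.mod_eq_of_lt (by omega)]
  have ht0 : (0 : ℝ) < t := by exact_mod_cast ht
  set q : ℝ := 2 * t with hq
  have hq0 : 0 < q := by positivity
  set c : ℝ := 2 * m + 1 with hc
  have hc0 : 0 < c := by positivity
  have hnc : (n : ℝ) - c = q * c + 1 := by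
    rw [hn', hc, hq]; push_cast; ring
  have hTc : T * (c + 1) = n.choose (2 * m + 1) * (q * c + 1) := by
    have h2 := Nat.choose_succ_right_eq n (2 * m + 1)
    have hle : 2 * m + 1 ≤ n := by rw [hn']; nlinarith
    rw [← hnc, hT, hc, show m + 1 + (m + 1) = 2 * m + 1 + 1 by ring]
    have h3 : ((2 * m + 1 : ℕ) : ℝ) = 2 * m + 1 := by push_cast; ring
    rw [← h3, ← Nat.cast_sub hle]
    exact_mod_cast h2
  have hMMS : MMS n k = T * (c + 1) / (q * (q * c + 1) + (c + 1)) := by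
    have h3 : ((2 * m + 1 : ℕ) : ℝ) = c := by push_cast; ring
    have h4 : (k : ℝ) - (1 : ℕ) = q := by rw [hk]; push_cast; ring
    rw [MMS, hdiv, hmod, h3, h4, hnc, hTc, Nat.cast_one, one_mul]
    field_simp
  -- `MMS` exceeds `T / (q² + 1)` by a factor of at most `(c + 1) / c`.
  have hA : (1 - ε / 3) * MMS n k ≤ T / (q ^ 2 + 1) := by
    have hcε : 1 ≤ ε / 3 * (c + 1) := by
      have : (K : ℝ) ≤ c + 1 := by
        have : (K : ℝ) ≤ m := by exact_mod_cast (by omega : K ≤ m)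
        rw [hc]; linarith
      calc (1 : ℝ) = ε / 3 * (3 / ε) := by field_simp
        _ ≤ ε / 3 * (c + 1) := by gcongr; linarith
    rw [hMMS, mul_div_assoc', div_le_div_iff₀ (by positivity) (by positivity)]
    have h5 : (1 - ε / 3) * (c + 1) ≤ c := by linarith
    have h6 : (1 - ε / 3) * (c + 1) * (q ^ 2 + 1) ≤ c * (q ^ 2 + 1) :=
      mul_le_mul_of_nonneg_right h5 (by positivity)
    have h7 : (1 - ε / 3) * (c + 1) * (q ^ 2 + 1) ≤ q * (q * c + 1) + (c + 1) := by nlinarith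
    have := mul_le_mul_of_nonneg_left h7 hT0
    linarith
  have hB : (1 - ε / 3) * (T / (q ^ 2 + 1)) ≤
      ((min (4 * t ^ 2) K : ℕ) : ℝ) / ((((min (4 * t ^ 2) K : ℕ) : ℝ) + 1) * ((4 * t ^ 2 : ℕ) : ℝ)) * T := by
    have hqD : ((4 * t ^ 2 : ℕ) : ℝ) = q ^ 2 := by rw [hq]; push_cast; ring
    rw [hqD]
    rcases le_total (4 * t ^ 2) K with h | h
    · rw [min_eq_left h, hqD]
      have : (q ^ 2 / ((q ^ 2 + 1) * q ^ 2)) * T = T / (q ^ 2 + 1) := by field_simp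
      rw [this]
      have : 0 ≤ T / (q ^ 2 + 1) := by positivity
      nlinarith
    · rw [min_eq_right h]
      have hKε : 1 - ε / 3 ≤ K / (K + 1) := by
        rw [le_div_iff₀ (by positivity)]
        have : 1 ≤ ε / 3 * K := by
          calc (1 : ℝ) = ε / 3 * (3 / ε) := by field_simp
            _ ≤ ε / 3 * K := by gcongr
        nlinarith
      calc (1 - ε / 3) * (T / (q ^ 2 + 1)) ≤ K / (K + 1) * (T / (q ^ 2 + 1)) := by gcongr
        _ ≤ K / (K + 1) * (T / q ^ 2) := by gcongr; linarith
        _ = _ := by field_simp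
  have hM0 : 0 ≤ MMS n k := by
    rw [hMMS]; positivity
  have hs : 0 ≤ 1 - ε / 3 := by linarith
  calc (1 - ε) * MMS n k ≤ (1 - ε / 3) * ((1 - ε / 3) * ((1 - ε / 3) * MMS n k)) := by
        have : 1 - ε ≤ (1 - ε / 3) * ((1 - ε / 3) * (1 - ε / 3)) := by
          nlinarith [mul_nonneg (sq_nonneg (ε / 3)) (show (0 : ℝ) ≤ 3 - ε / 3 by linarith)]
        have := mul_le_mul_of_nonneg_right this hM0
        linarith
    _ ≤ (1 - ε / 3) * ((1 - ε / 3) * (T / (q ^ 2 + 1))) := by gcongr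
    _ ≤ _ := mul_le_mul_of_nonneg_left hB hs
    _ ≤ SP n k := h1

/-- Here `c = 2 m`, `r = k - 1`, and `binom(n, c + 1) = 2 t binom(n, c)` exactly. Using half of each
layer (`L = 1`) makes the main term of the construction equal to `MMS`. -/
theorem eventually_MMS_le_SP_of_sub_one {ε : ℝ} (hε : 0 < ε) :
    ∃ m₀ : ℕ, ∀ m ≥ m₀, ∀ n k t : ℕ, 1 ≤ t → k = 2 * t + 1 →
      n = 2 * (m + t * (2 * m + 1)) → (1 - ε) * MMS n k ≤ SP n k := by
  obtain ⟨m₀, hm₀⟩ := eventually_le_SP hε 1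
  refine ⟨m₀, fun m hm n k t ht hk hn => ?_⟩
  have h1 := hm₀ m hm n k m t 1 (2 * t) ht hk hn le_rfl le_rfl (Or.inr ⟨rfl, rfl, rfl⟩)
  refine le_trans (le_of_eq ?_) h1
  have hn' : n = (2 * t + 1) * (2 * m) + 2 * t := by rw [hn]; ring
  have hdiv : n / k = 2 * m := by
    rw [hk, hn', Nat.mul_add_div (by omega), Nat.div_eq_of_lt (by omega), Nat.add_zero]
  have hmod : n % k = 2 * t := by
    rw [hk, hn', Nat.mul_add_mod, Nat.mod_eq_of_lt (by omega)]
  have ht0 : (0 : ℝ) < t := by exact_mod_cast ht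
  have hnc : (n : ℝ) - (2 * m : ℕ) = 2 * t * (2 * m + 1) := by
    rw [hn']; push_cast; ring
  have hT : (n.choose (m + 1 + m) : ℝ) = 2 * t * n.choose (2 * m) := by
    have h2 := Nat.choose_succ_right_eq n (2 * m)
    have hle : 2 * m ≤ n := by rw [hn']; nlinarith
    have h3 : (n.choose (2 * m + 1) : ℝ) * (2 * m + 1) = n.choose (2 * m) * (2 * t * (2 * m + 1)) := by
      rw [← hnc, ← Nat.cast_sub hle]
      exact_mod_cast h2
    rw [show m + 1 + m = 2 * m + 1 by ring]
    have h4 : (0 : ℝ) < 2 * m + 1 := by positivity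
    refine mul_right_cancel₀ h4.ne' ?_
    rw [h3]; ring
  rw [MMS, hdiv, hmod, hnc, hT, hk]
  push_cast
  field_simp
  ring

/-- The asymptotic statement, from a uniform lower bound for large `n / k`. -/
theorem isEquivalent_SP_MMS {n k m : ℕ → ℕ} (hn : Tendsto n atTop atTop)
    (hkn : (fun i => (k i : ℝ)) =o[atTop] (fun i => (n i : ℝ))) (hk : ∀ i, 2 ≤ k i)
    (hm : ∀ i, n i ≤ 2 * k i * (m i + 1))
    (hlow : ∀ ε : ℝ, 0 < ε → ∃ m₀ : ℕ, ∀ i, m₀ ≤ m i →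
      (1 - ε) * MMS (n i) (k i) ≤ SP (n i) (k i)) :
    (fun i => (SP (n i) (k i) : ℝ)) ~[atTop] (fun i => MMS (n i) (k i)) := by
  -- `n ≤ 2 k (m + 1)` and `k = o(n)` force `m → ∞`, whatever the behaviour of `k`.
  have hmlim : ∀ m₀ : ℕ, ∀ᶠ i in atTop, m₀ ≤ m i := by
    intro m₀
    have h1 := (isLittleO_iff.1 hkn) (show (0 : ℝ) < 1 / (2 * (m₀ + 1)) by positivity)
    filter_upwards [h1, hn.eventually_gt_atTop 0] with i hi hi0
    simp only [RCLike.norm_natCast] at hi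
    rw [div_mul_eq_mul_div, one_mul, le_div_iff₀ (by positivity)] at hi
    have hi' : k i * (2 * (m₀ + 1)) ≤ n i := by exact_mod_cast hi
    have h2 := hi'.trans (hm i)
    have h3 : (2 * k i) * (m₀ + 1) ≤ (2 * k i) * (m i + 1) := by linarith
    have := Nat.le_of_mul_le_mul_left h3 (by have := hk i; omega)
    omega
  rw [IsEquivalent, isLittleO_iff]
  intro ε hε
  obtain ⟨m₀, hm₀⟩ := hlow ε hε
  have hkn' : ∀ᶠ i in atTop, k i ≤ n i := by
    filter_upwards [(isLittleO_iff.1 hkn) one_pos] with i hi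
    simp only [RCLike.norm_natCast, one_mul] at hi
    exact_mod_cast hi
  filter_upwards [hmlim m₀, hkn'] with i hi hi'
  have h1 := hm₀ i hi
  have h2 := SP_le_MMS (hk i) hi'
  have h3 : 0 ≤ MMS (n i) (k i) := le_trans (Nat.cast_nonneg _) h2
  rw [Pi.sub_apply, Real.norm_eq_abs, Real.norm_eq_abs, abs_of_nonneg h3, abs_le]
  constructor
  · linarith
  · have := mul_nonneg hε.le h3
    linarith

theorem theorem4 :
    (∀ n k : ℕ → ℕ, Tendsto n atTop atTop →
      (fun i => (k i : ℝ)) =o[atTop] (fun i => (n i : ℝ)) →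
      (∀ i, 3 ≤ k i ∧ Odd (k i) ∧ n i ≡ k i + 1 [MOD 2 * k i]) →
      (fun i => (SP (n i) (k i) : ℝ)) ~[atTop] (fun i => MMS (n i) (k i))) ∧
    (∀ n k : ℕ → ℕ, Tendsto n atTop atTop →
      (fun i => (k i : ℝ)) =o[atTop] (fun i => (n i : ℝ)) →
      (∀ i, 5 ≤ k i ∧ Odd (k i) ∧ n i ≡ k i - 1 [MOD 2 * k i]) →
      (fun i => (SP (n i) (k i) : ℝ)) ~[atTop] (fun i => MMS (n i) (k i))) := by
  constructor
  · intro n k hn hkn hi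
    -- That is, `n = k (2 m + 1) + 1` with `m = n / (2 k)`.
    have hdecomp : ∀ i, n i = 2 * k i * (n i / (2 * k i)) + (k i + 1) := by
      intro i
      have h1 := (hi i).2.2
      have h2 := (hi i).1
      rw [Nat.ModEq, Nat.mod_eq_of_lt (show k i + 1 < 2 * k i by omega)] at h1
      rw [← h1, Nat.div_add_mod]
    refine isEquivalent_SP_MMS (m := fun i => n i / (2 * k i)) hn hkn
      (fun i => by have := (hi i).1; omega) (fun i => ?_) (fun ε hε => ?_)
    · have h1 := hdecomp i
      have h2 := (hi i).1
      rw [mul_add, mul_one]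
      omega
    · obtain ⟨m₀, hm₀⟩ := eventually_MMS_le_SP_of_one hε
      refine ⟨m₀, fun i hmi => ?_⟩
      obtain ⟨t, ht⟩ := (hi i).2.1
      have h2 := (hi i).1
      refine hm₀ _ hmi _ _ t (by omega) ht ?_
      refine (hdecomp i).trans ?_
      generalize n i / (2 * k i) = m
      rw [ht]
      ring
  · intro n k hn hkn hi
    -- That is, `n = k (2 m) + (k - 1)` with `m = n / (2 k)`.
    have hdecomp : ∀ i, n i = 2 * k i * (n i / (2 * k i)) + (k i - 1) := by
      intro i
      have h1 := (hi i).2.2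
      have h2 := (hi i).1
      rw [Nat.ModEq, Nat.mod_eq_of_lt (show k i - 1 < 2 * k i by omega)] at h1
      rw [← h1, Nat.div_add_mod]
    refine isEquivalent_SP_MMS (m := fun i => n i / (2 * k i)) hn hkn
      (fun i => by have := (hi i).1; omega) (fun i => ?_) (fun ε hε => ?_)
    · have h1 := hdecomp i
      have h2 := (hi i).1
      rw [mul_add, mul_one]
      omega
    · obtain ⟨m₀, hm₀⟩ := eventually_MMS_le_SP_of_sub_one hε
      refine ⟨m₀, fun i hmi => ?_⟩
      obtain ⟨t, ht⟩ := (hi i).2.1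
      have h2 := (hi i).1
      refine hm₀ _ hmi _ _ t (by omega) ht ?_
      refine (hdecomp i).trans ?_
      generalize n i / (2 * k i) = m
      rw [ht, Nat.add_sub_cancel]
      ring
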